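/- Conventions. A two-way nondeterministic finite automaton (2NFA) over an alphabet $\Sigma$ has a finite state set $Q$, an initial state $q_0$, a set $F\subseteq Q$ of final states and a transition function $\delta: Q\times(\Sigma\cup\{\triangleright,\triangleleft\})\to 2^{Q\times\{-1,+1\}}$. On input $w\in\Sigma^*$ its tape contains $\triangleright w\triangleleft$, with $\triangleright$ at position $0$; in each move it reads the scanned symbol, changes its state and moves its head by $-1$ or $+1$, never passing the endmarkers. It accepts $w$ if some computation that starts in $q_0$ with the head at position $1$ eventually halts in a state of $F$ with the head on $\triangleleft$. It is deterministic (a 2DFA) if $|\delta(q,\sigma)|\le 1$ for all $q\in Q$ and $\sigma\in\Sigma\cup\{\triangleright,\triangleleft\}$; a one-way DFA is a 2DFA without any transition that moves the head by $-1$. A 2DFA with common-guess with input alphabet $\Sigma$ and annotation alphabet $\Gamma$ is given by a 2DFA $\mathcal A$ over $\Sigma\times\Gamma$; its states are those of $\mathcal A$, and it recognizes $\pi_1(L(\mathcal A))\subseteq\Sigma^*$, where $\pi_1:(\Sigma\times\Gamma)^*\to\Sigma^*$ is the letterwise first projection. For $k\in\mathbb N$ let $k\#$ be the product of all primes $p\le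 k$. Theorem. For $n\in\mathbb N=\{0,1,2,\dots\}$ let $M_n$ be the language over the one-letter alphabet $\{a\}$ given by $$M_n=\{a^{kd} : k\ge 0,\ 1<d\le 2^n(n+1)+1\}.$$ 1. There is a function $s:\mathbb N\to\mathbb N$ with $s(n)=O(n)$ as $n\to\infty$ such that, for every $n\in\mathbb N$, $M_n$ is recognized by a 2DFA with common-guess that has $s(n)$ states and $4$ annotation symbols. 2. For every $n\in\mathbb N$, the minimum number of states of a one-way DFA recognizing $M_n$ is exactly $\bigl(2^n(n+1)+1\bigr)\#$, and $\bigl(2^n(n+1)+1\bigr)\#>2^{2^n n}$. -/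

import Mathlib

/-- Symbols found on the tape of a two-way automaton over the input alphabet `σ`:
letters of `σ` and the two endmarkers. -/
inductive TapeSymbol (σ : Type) : Type
  | leftEnd : TapeSymbol σ
  | letter (a : σ) : TapeSymbol σ
  | rightEnd : TapeSymbol σ

/-- Head moves: one position backward (`-1`) or one position forward (`+1`). -/
inductive HeadMove : Type
  | backward : HeadMove
  | forward : HeadMove

/-- The content of the tape on input `w`: the left endmarker at position `0`, the letters of `w`
at positions `1, …, |w|`, and the right endmarker at position `|w| + 1`
(larger positions are never reached by the head of an automaton). -/
def tapeAt {σ : Type} (w : List σ) : ℕ → TapeSymbol σ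
  | 0 => TapeSymbol.leftEnd
  | i + 1 =>
    match w[i]? with
    | some a => TapeSymbol.letter a
    | none => TapeSymbol.rightEnd

/-- A two-way nondeterministic automaton with state set `Q` and input alphabet `σ`. Finiteness of
`Q` is required where automata are used. The last two fields say that the head cannot pass the
endmarkers. -/
structure TwoNFA (σ Q : Type) where
  /-- transition function -/
  δ : Q → TapeSymbol σ → Set (Q × HeadMove)
  /-- initial state -/
  start : Q
  /-- final states -/
  final : Set Q
  not_pass_left : ∀ p q : Q, (q, HeadMove.backward) ∉ δ p TapeSymbol.leftEnd
  not_pass_right : ∀ p q : Q, (q, HeadMove.forward) ∉ δ p TapeSymbol.rightEnd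

namespace TwoNFA

variable {σ Q : Type}

/-- One move of the automaton on input `w`. A configuration is a pair made of the current state
and the current position of the head. -/
def Step (A : TwoNFA σ Q) (w : List σ) (c c' : Q × ℕ) : Prop :=
  ((c'.1, HeadMove.forward) ∈ A.δ c.1 (tapeAt w c.2) ∧ c'.2 = c.2 + 1) ∨
  ((c'.1, HeadMove.backward) ∈ A.δ c.1 (tapeAt w c.2) ∧ c'.2 + 1 = c.2)

/-- The automaton accepts `w` if some computation path that starts in the initial state with the
head at position `1` eventually halts (no further move is possible) in a final state with the head
scanning the right endmarker. -/
def Accepts (A : TwoNFA σ Q) (w : List σ) : Prop :=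
  ∃ q ∈ A.final,
    Relation.ReflTransGen (A.Step w) (A.start, 1) (q, w.length + 1) ∧
    ∀ c : Q × ℕ, ¬ A.Step w (q, w.length + 1) c

/-- The accepted language. -/
def language (A : TwoNFA σ Q) : Language σ := {w | A.Accepts w}

/-- Deterministic (2DFA): at most one transition for each state and each tape symbol. -/
def IsDeterministic (A : TwoNFA σ Q) : Prop :=
  ∀ (q : Q) (s : TapeSymbol σ), (A.δ q s).Subsingleton

/-- One-way: no transition moves the head backward. -/
def IsOneWay (A : TwoNFA σ Q) : Prop :=
  ∀ (p q : Q) (s : TapeSymbol σ), (q, HeadMove.backward) ∉ A.δ p s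

end TwoNFA

/-- A two-way automaton with common-guess, with input alphabet `σ`, annotation alphabet `Γ` and
state set `Q`: it is given by a two-way automaton over the product alphabet `σ × Γ`. -/
structure TwoNFACommonGuess (σ Γ Q : Type) where
  /-- the underlying two-way automaton, reading annotated words -/
  automaton : TwoNFA (σ × Γ) Q

namespace TwoNFACommonGuess

variable {σ Γ Q : Type}

/-- The recognized language: the projection to `σ` of the language of annotated words accepted by
the underlying automaton. -/
def language (M : TwoNFACommonGuess σ Γ Q) : Language σ :=
  {w | ∃ v : List (σ × Γ), v ∈ M.automaton.language ∧ v.map Prod.fst = w}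

/-- 2DFA with common-guess: the underlying two-way automaton is deterministic. -/
def IsDeterministic (M : TwoNFACommonGuess σ Γ Q) : Prop := M.automaton.IsDeterministic

end TwoNFACommonGuess

/-- The unary language `M_n = {a ^ (k d) | k ≥ 0, 1 < d ≤ 2 ^ n (n + 1) + 1}`, where the one-letter
alphabet `{a}` is `Unit`. -/
def unaryM (n : ℕ) : Language Unit :=
  {w | ∃ k d : ℕ, 1 < d ∧ d ≤ 2 ^ n * (n + 1) + 1 ∧ w = List.replicate (k * d) ()}

/-- `L` is recognized by a 2DFA with common-guess that has `s` states and `g` annotation symbols. -/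
def RecognizedByTwoDFACommonGuess {σ : Type} (L : Language σ) (s g : ℕ) : Prop :=
  ∃ (Q Γ : Type) (_ : Fintype Q) (_ : Fintype Γ) (M : TwoNFACommonGuess σ Γ Q),
    M.IsDeterministic ∧ M.language = L ∧ Fintype.card Q = s ∧ Fintype.card Γ = g

/-- `L` is recognized by a one-way deterministic finite automaton that has `s` states. -/
def RecognizedByOneWayDFA {σ : Type} (L : Language σ) (s : ℕ) : Prop :=
  ∃ (Q : Type) (_ : Fintype Q) (A : TwoNFA σ Q),
    A.IsDeterministic ∧ A.IsOneWay ∧ A.language = L ∧ Fintype.card Q = s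

/-! ### Generalities on two-way automata -/

theorem tapeAt_succ {α : Type} (w : List α) {i : ℕ} (hi : i < w.length) :
    tapeAt w (i + 1) = TapeSymbol.letter w[i] := by
  simp [tapeAt, hi]

theorem tapeAt_length_succ {α : Type} (w : List α) :
    tapeAt w (w.length + 1) = TapeSymbol.rightEnd := by
  simp [tapeAt]

namespace TwoNFA

variable {α Q Q₁ Q₂ S : Type}

theorem Step.le_length {A : TwoNFA α Q} {w : List α} {c c' : Q × ℕ} (h : A.Step w c c')
    (hc : c.2 ≤ w.length + 1) : c'.2 ≤ w.length + 1 := by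
  rcases h with ⟨h, h'⟩ | ⟨h, h'⟩
  · rcases hc.lt_or_eq with hlt | heq
    · omega
    · rw [heq, tapeAt_length_succ] at h
      exact absurd h (A.not_pass_right _ _)
  · omega

theorem halts_iff {A : TwoNFA α Q} {w : List α} {q : Q} :
    (∀ c : Q × ℕ, ¬ A.Step w (q, w.length + 1) c) ↔ A.δ q TapeSymbol.rightEnd = ∅ := by
  constructor
  · intro h
    ext ⟨q', d⟩
    simp only [Set.mem_empty_iff_false, iff_false]
    intro hq
    cases d with
    | forward => exact A.not_pass_right _ _ hq
    | backward => exact h (q', w.length) (Or.inr ⟨by simpa [tapeAt_length_succ] using hq, rfl⟩)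
  · intro h c hc
    simp [Step, tapeAt_length_succ, h] at hc

theorem accepts_iff {A : TwoNFA α Q} {w : List α} :
    A.Accepts w ↔ ∃ q ∈ A.final,
      Relation.ReflTransGen (A.Step w) (A.start, 1) (q, w.length + 1) ∧
      A.δ q TapeSymbol.rightEnd = ∅ := by
  simp only [Accepts, halts_iff]

/-- Acceptance by a one-way automaton in terms of the sequence of visited states. -/
theorem IsOneWay.accepts_iff {A : TwoNFA α Q} (hA : A.IsOneWay) {w : List α} :
    A.Accepts w ↔ ∃ s : ℕ → Q, s 0 = A.start ∧
      (∀ (i : ℕ) (hi : i < w.length),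
        (s (i + 1), HeadMove.forward) ∈ A.δ (s i) (TapeSymbol.letter w[i])) ∧
      s w.length ∈ A.final := by
  rw [TwoNFA.accepts_iff]
  constructor
  · rintro ⟨q, hq, hr, -⟩
    have key : ∀ c : Q × ℕ, Relation.ReflTransGen (A.Step w) (A.start, 1) c →
        ∃ n ≤ w.length, c.2 = n + 1 ∧ ∃ s : ℕ → Q, s 0 = A.start ∧
        (∀ (i : ℕ) (hi : i < w.length), i < n →
          (s (i + 1), HeadMove.forward) ∈ A.δ (s i) (TapeSymbol.letter w[i])) ∧ s n = c.1 := by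
      intro c hc
      induction hc with
      | refl => exact ⟨0, Nat.zero_le _, rfl, fun _ => A.start, rfl, by simp, rfl⟩
      | @tail b c hb hs ih =>
        obtain ⟨n, hn, hbn, s, h0, hstep, hsn⟩ := ih
        rcases hs with ⟨h, h'⟩ | ⟨h, h'⟩
        · rcases hn.lt_or_eq with hlt | heq
          · refine ⟨n + 1, hlt, by omega, fun i => if i ≤ n then s i else c.1, by simp [h0], ?_,
              by simp⟩
            intro i hi hin
            rcases Nat.lt_succ_iff_lt_or_eq.mp hin with hi' | rfl
            · simpa [hi'.le, Nat.succ_le_of_lt hi'] using hstep i hi hi'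
            · simpa [hsn, hbn, tapeAt_succ w hlt] using h
          · rw [hbn, heq, tapeAt_length_succ] at h
            exact absurd h (A.not_pass_right _ _)
        · exact absurd h (hA _ _ _)
    obtain ⟨n, -, hn, s, h0, hs, hsn⟩ := key _ hr
    obtain rfl : w.length = n := by simpa using hn
    exact ⟨s, h0, fun i hi => hs i hi hi, by rwa [hsn]⟩
  · rintro ⟨s, h0, hs, hf⟩
    refine ⟨_, hf, ?_, ?_⟩
    · have key : ∀ n ≤ w.length,
          Relation.ReflTransGen (A.Step w) (A.start, 1) (s n, n + 1) := by
        intro n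
        induction n with
        | zero => intro _; rw [h0]
        | succ n ih =>
          intro hn
          refine (ih (by omega)).tail (Or.inl ⟨?_, rfl⟩)
          rw [tapeAt_succ w (by omega)]
          exact hs n (by omega)
      exact key _ le_rfl
    · ext ⟨q', d⟩
      simp only [Set.mem_empty_iff_false, iff_false]
      intro h
      cases d with
      | forward => exact A.not_pass_right _ _ h
      | backward => exact hA _ _ _ h

/-! ### Automata given by a transition function restricted to a finite set of states -/

/-- The automaton whose states are the elements of `F` and whose moves are those of `f` that stay
in `F` and do not pass the endmarkers. -/
def ofFun (F : Finset S) (f : S → TapeSymbol α → Option (S × HeadMove)) (s₀ : F) (acc : Set S) :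
    TwoNFA α F where
  δ q a := {p | f q a = some (p.1.1, p.2) ∧ (a = TapeSymbol.leftEnd → p.2 = HeadMove.forward) ∧
    (a = TapeSymbol.rightEnd → p.2 = HeadMove.backward)}
  start := s₀
  final := {q | q.1 ∈ acc}
  not_pass_left p q h := by simpa using h.2.1 rfl
  not_pass_right p q h := by simpa using h.2.2 rfl

theorem ofFun_isDeterministic (F : Finset S) (f : S → TapeSymbol α → Option (S × HeadMove))
    (s₀ : F) (acc : Set S) : (ofFun F f s₀ acc).IsDeterministic := by
  rintro q a ⟨⟨p, hp⟩, d⟩ ⟨h, -⟩ ⟨⟨p', hp'⟩, d'⟩ ⟨h', -⟩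
  have := h.symm.trans h'
  simp only [Option.some.injEq, Prod.mk.injEq] at this
  obtain ⟨rfl, rfl⟩ := this
  rfl

/-- One move of the automaton given by `f` that stays in `F`. -/
def FunStep (F : Finset S) (f : S → TapeSymbol α → Option (S × HeadMove)) (w : List α)
    (c c' : S × ℕ) : Prop :=
  c'.1 ∈ F ∧ ((f c.1 (tapeAt w c.2) = some (c'.1, HeadMove.forward) ∧ c'.2 = c.2 + 1 ∧
    c.2 ≤ w.length) ∨ (f c.1 (tapeAt w c.2) = some (c'.1, HeadMove.backward) ∧ c'.2 + 1 = c.2))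

theorem ofFun_accepts_of_run {F : Finset S} {f : S → TapeSymbol α → Option (S × HeadMove)}
    {s₀ : F} {acc : Set S} {w : List α} {q : S}
    (hr : Relation.ReflTransGen (FunStep F f w) (s₀.1, 1) (q, w.length + 1)) (hq : q ∈ acc)
    (hh : f q TapeSymbol.rightEnd = none) : (ofFun F f s₀ acc).Accepts w := by
  have key : ∀ c, Relation.ReflTransGen (FunStep F f w) (s₀.1, 1) c → ∃ h : c.1 ∈ F,
      Relation.ReflTransGen ((ofFun F f s₀ acc).Step w) (s₀, 1) (⟨c.1, h⟩, c.2) := by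
    intro c hc
    induction hc with
    | refl => exact ⟨s₀.2, .refl⟩
    | @tail b c hb hs ih =>
      obtain ⟨h, ih⟩ := ih
      refine ⟨hs.1, ih.tail ?_⟩
      rcases hs.2 with ⟨h1, h2, h3⟩ | ⟨h1, h2⟩
      · refine Or.inl ⟨⟨h1, by simp, fun h4 => ?_⟩, h2⟩
        exfalso
        obtain ⟨b1, i⟩ := b
        cases i with
        | zero => simp [tapeAt] at h4
        | succ i => simp [tapeAt_succ w (show i < w.length from h3)] at h4
      · refine Or.inr ⟨⟨h1, fun h4 => ?_, by simp⟩, h2⟩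
        exfalso
        obtain ⟨b1, i⟩ := b
        cases i with
        | zero => simp at h2
        | succ i =>
          by_cases hi : i < w.length
          · simp [tapeAt_succ w hi] at h4
          · simp [tapeAt, List.getElem?_eq_none (not_lt.mp hi)] at h4
  obtain ⟨h, hr'⟩ := key _ hr
  rw [TwoNFA.accepts_iff]
  refine ⟨_, hq, hr', ?_⟩
  ext p
  simp [ofFun, hh]

theorem exists_of_ofFun_accepts {F : Finset S} {f : S → TapeSymbol α → Option (S × HeadMove)}
    {s₀ : F} {acc : Set S} {w : List α} (I : S → ℕ → Prop) (h0 : I s₀ 1)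
    (hf : ∀ q q' i, q ∈ F → q' ∈ F → i ≤ w.length → I q i →
      f q (tapeAt w i) = some (q', HeadMove.forward) → I q' (i + 1))
    (hb : ∀ q q' i, q ∈ F → q' ∈ F → i ≤ w.length → I q (i + 1) →
      f q (tapeAt w (i + 1)) = some (q', HeadMove.backward) → I q' i)
    (h : (ofFun F f s₀ acc).Accepts w) : ∃ q ∈ F, q ∈ acc ∧ I q (w.length + 1) := by
  rw [TwoNFA.accepts_iff] at h
  obtain ⟨q, hq, hr, -⟩ := h
  have key : ∀ c, Relation.ReflTransGen ((ofFun F f s₀ acc).Step w) (s₀, 1) c →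
      c.2 ≤ w.length + 1 ∧ I c.1 c.2 := by
    intro c hc
    induction hc with
    | refl => exact ⟨by simp, h0⟩
    | @tail b c _ hs ih =>
      have hle := hs.le_length ih.1
      refine ⟨hle, ?_⟩
      rcases hs with ⟨h1, h2⟩ | ⟨h1, h2⟩
      · rw [h2]
        exact hf b.1 c.1 b.2 b.1.2 c.1.2 (by omega) ih.2 h1.1
      · refine hb b.1 c.1 c.2 b.1.2 c.1.2 (by omega) (h2 ▸ ih.2) ?_
        rw [h2]
        exact h1.1
  exact ⟨q.1, q.2, hq, (key _ hr).2⟩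

/-- The one-way automaton whose states are the elements of `F` and whose moves are those of the
partial function `next` that stay in `F`. -/
def oneWay (F : Finset S) (next : S → α → Option S) (s₀ : F) (acc : Set S) : TwoNFA α F :=
  ofFun F (fun q a => match a with
    | TapeSymbol.letter a => (next q a).map fun q' => (q', HeadMove.forward)
    | _ => none) s₀ acc

theorem oneWay_isDeterministic (F : Finset S) (next : S → α → Option S) (s₀ : F) (acc : Set S) :
    (oneWay F next s₀ acc).IsDeterministic :=
  ofFun_isDeterministic _ _ _ _

theorem oneWay_isOneWay (F : Finset S) (next : S → α → Option S) (s₀ : F) (acc : Set S) :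
    (oneWay F next s₀ acc).IsOneWay := by
  rintro p q a ⟨h, -⟩
  cases a <;> simp at h

theorem oneWay_accepts_iff {F : Finset S} {next : S → α → Option S} {s₀ : F} {acc : Set S}
    {w : List α} : (oneWay F next s₀ acc).Accepts w ↔ ∃ s : ℕ → S, s 0 = s₀ ∧
      (∀ i ≤ w.length, s i ∈ F) ∧
      (∀ (i : ℕ) (hi : i < w.length), next (s i) w[i] = some (s (i + 1))) ∧
      s w.length ∈ acc := by
  rw [(oneWay_isOneWay F next s₀ acc).accepts_iff]
  constructor
  · rintro ⟨s, h0, hs, ha⟩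
    refine ⟨fun i => s i, by simp [h0, oneWay, ofFun], fun i _ => (s i).2, fun i hi => ?_, ha⟩
    simpa using (hs i hi).1
  · rintro ⟨s, h0, hF, hs, ha⟩
    refine ⟨fun i => if h : i ≤ w.length then ⟨s i, hF i h⟩ else s₀, by simp [h0, oneWay, ofFun],
      fun i hi => ?_, by simpa [oneWay, ofFun] using ha⟩
    refine ⟨?_, by simp, by simp⟩
    simp [hs i hi, hi.le, Nat.succ_le_of_lt hi]

/-! ### Intersection -/

/-- Run `A`; if it accepts, rewind the tape and run `B`. -/
def inter (A : TwoNFA α Q₁) (B : TwoNFA α Q₂) : TwoNFA α (Q₁ ⊕ Unit ⊕ Q₂) where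
  δ
    | Sum.inl q, a => {p | (∃ q', p.1 = Sum.inl q' ∧ (q', p.2) ∈ A.δ q a) ∨
        (a = TapeSymbol.rightEnd ∧ q ∈ A.final ∧ A.δ q TapeSymbol.rightEnd = ∅ ∧
          p = (Sum.inr (Sum.inl ()), HeadMove.backward))}
    | Sum.inr (Sum.inl _), a =>
        {p | (a ≠ TapeSymbol.leftEnd ∧ p = (Sum.inr (Sum.inl ()), HeadMove.backward)) ∨
        (a = TapeSymbol.leftEnd ∧ p = (Sum.inr (Sum.inr B.start), HeadMove.forward))}
    | Sum.inr (Sum.inr q), a => {p | ∃ q', p.1 = Sum.inr (Sum.inr q') ∧ (q', p.2) ∈ B.δ q a}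
  start := Sum.inl A.start
  final := {p | ∃ q ∈ B.final, p = Sum.inr (Sum.inr q)}
  not_pass_left p q h := by
    rcases p with p | p | p
    · rcases h with ⟨q', -, h⟩ | ⟨h, -⟩
      · exact A.not_pass_left _ _ h
      · simp at h
    · simp at h
    · obtain ⟨q', -, h⟩ := h
      exact B.not_pass_left _ _ h
  not_pass_right p q h := by
    rcases p with p | p | p
    · rcases h with ⟨q', -, h⟩ | ⟨-, -, -, h⟩
      · exact A.not_pass_right _ _ h
      · simp at h
    · simp at h
    · obtain ⟨q', -, h⟩ := h
      exact B.not_pass_right _ _ h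

theorem inter_isDeterministic {A : TwoNFA α Q₁} {B : TwoNFA α Q₂} (hA : A.IsDeterministic)
    (hB : B.IsDeterministic) : (A.inter B).IsDeterministic := by
  rintro (q | q | q) a ⟨x, d⟩ hx ⟨y, e⟩ hy
  · rcases hx with ⟨x', rfl, hx⟩ | ⟨rfl, -, hx, hx'⟩ <;>
      rcases hy with ⟨y', rfl, hy⟩ | ⟨h, -, hy, hy'⟩
    · have := hA q a hx hy
      simp_all
    · simp_all
    · simp_all
    · rw [hx', hy']
  · rcases hx with ⟨h, hx⟩ | ⟨h, hx⟩ <;> rcases hy with ⟨h', hy⟩ | ⟨h', hy⟩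
    · rw [hx, hy]
    · exact absurd h' h
    · exact absurd h h'
    · rw [hx, hy]
  · obtain ⟨x', rfl, hx⟩ := hx
    obtain ⟨y', rfl, hy⟩ := hy
    have := hB q a hx hy
    simp_all

theorem inter_accepts_iff {A : TwoNFA α Q₁} {B : TwoNFA α Q₂} {w : List α} :
    (A.inter B).Accepts w ↔ A.Accepts w ∧ B.Accepts w := by
  constructor
  · intro h
    rw [accepts_iff] at h
    obtain ⟨_, ⟨qB, hqB, rfl⟩, hr, hh⟩ := h
    have key : ∀ c, Relation.ReflTransGen ((A.inter B).Step w) (Sum.inl A.start, 1) c →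
        c.2 ≤ w.length + 1 ∧
        (∀ q, c.1 = Sum.inl q → Relation.ReflTransGen (A.Step w) (A.start, 1) (q, c.2)) ∧
        (∀ u, c.1 = Sum.inr u → A.Accepts w) ∧
        (∀ q, c.1 = Sum.inr (Sum.inr q) →
          Relation.ReflTransGen (B.Step w) (B.start, 1) (q, c.2)) := by
      intro c hc
      induction hc with
      | refl => exact ⟨by simp, by rintro _ ⟨⟩; exact .refl, by simp, by simp⟩
      | @tail b c _ hs ih =>
        obtain ⟨ih0, ih1, ih2, ih3⟩ := ih
        have hle := hs.le_length ih0
        refine ⟨hle, ?_⟩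
        obtain ⟨b, i⟩ := b
        obtain ⟨c, j⟩ := c
        rcases b with q | q | q
        · have h1 := ih1 q rfl
          rcases hs with ⟨⟨q', hc, h⟩ | ⟨-, -, -, h⟩, h'⟩ | ⟨⟨q', hc, h⟩ | ⟨he, hf, hd, h⟩, h'⟩
          · simp only at hc h'
            subst hc
            refine ⟨?_, by simp, by simp⟩
            rintro _ ⟨⟩
            exact h1.tail (Or.inl ⟨h, h'⟩)
          · simp at h
          · simp only at hc h'
            subst hc
            refine ⟨?_, by simp, by simp⟩
            rintro _ ⟨⟩
            exact h1.tail (Or.inr ⟨h, h'⟩)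
          · simp only [Prod.mk.injEq, and_true] at h
            subst h
            refine ⟨by simp, fun _ _ => ?_, by simp⟩
            rw [accepts_iff]
            refine ⟨q, hf, ?_, hd⟩
            have hi : i = w.length + 1 := by
              simp only at ih0 he
              by_contra hne
              cases i with
              | zero => simp [tapeAt] at he
              | succ i => simp [tapeAt_succ w (show i < w.length by omega)] at he
            simpa [hi] using h1
        · have h2 := ih2 _ rfl
          rcases hs with ⟨⟨-, h⟩ | ⟨he, h⟩, h'⟩ | ⟨⟨-, h⟩ | ⟨-, h⟩, h'⟩
          · simp at h
          · simp only [Prod.mk.injEq, and_true] at h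
            subst h
            refine ⟨by simp, fun _ _ => h2, ?_⟩
            rintro _ ⟨⟩
            have hi : i = 0 := by
              simp only at ih0 he
              by_contra hne
              obtain ⟨i, rfl⟩ := Nat.exists_eq_succ_of_ne_zero hne
              by_cases hi : i < w.length
              · simp [tapeAt_succ w hi] at he
              · simp [tapeAt, List.getElem?_eq_none (not_lt.mp hi)] at he
            simp only at h'
            rw [h', hi]
          · simp only [Prod.mk.injEq, and_true] at h
            subst h
            exact ⟨by simp, fun _ _ => h2, by simp⟩
          · simp at h
        · have h2 := ih2 _ rfl
          have h3 := ih3 _ rfl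
          rcases hs with ⟨⟨q', hc, h⟩, h'⟩ | ⟨⟨q', hc, h⟩, h'⟩
          · simp only at hc h'
            subst hc
            refine ⟨by simp, fun _ _ => h2, ?_⟩
            rintro _ ⟨⟩
            exact h3.tail (Or.inl ⟨h, h'⟩)
          · simp only at hc h'
            subst hc
            refine ⟨by simp, fun _ _ => h2, ?_⟩
            rintro _ ⟨⟩
            exact h3.tail (Or.inr ⟨h, h'⟩)
    obtain ⟨-, -, h2, h3⟩ := key _ hr
    refine ⟨h2 _ rfl, accepts_iff.mpr ⟨qB, hqB, h3 _ rfl, ?_⟩⟩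
    ext p
    simp only [Set.mem_empty_iff_false, iff_false]
    intro hp
    have : ((Sum.inr (Sum.inr p.1), p.2) : (Q₁ ⊕ Unit ⊕ Q₂) × HeadMove) ∈
        (A.inter B).δ (Sum.inr (Sum.inr qB)) TapeSymbol.rightEnd := ⟨p.1, rfl, hp⟩
    simp [hh] at this
  · rintro ⟨hA, hB⟩
    rw [accepts_iff] at hA hB ⊢
    obtain ⟨qA, hqA, hrA, hhA⟩ := hA
    obtain ⟨qB, hqB, hrB, hhB⟩ := hB
    refine ⟨_, ⟨qB, hqB, rfl⟩, ?_, ?_⟩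
    · have h1 : Relation.ReflTransGen ((A.inter B).Step w) (Sum.inl A.start, 1)
          (Sum.inl qA, w.length + 1) := by
        refine Relation.ReflTransGen.lift (fun c : Q₁ × ℕ => (Sum.inl c.1, c.2)) ?_ _ _ hrA
        rintro c c' (⟨h, h'⟩ | ⟨h, h'⟩)
        · exact Or.inl ⟨Or.inl ⟨c'.1, rfl, h⟩, h'⟩
        · exact Or.inr ⟨Or.inl ⟨c'.1, rfl, h⟩, h'⟩
      have h2 : (A.inter B).Step w (Sum.inl qA, w.length + 1) (Sum.inr (Sum.inl ()), w.length) :=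
        Or.inr ⟨Or.inr ⟨tapeAt_length_succ w, hqA, hhA, rfl⟩, rfl⟩
      have h3 : ∀ n ≤ w.length, Relation.ReflTransGen ((A.inter B).Step w)
          (Sum.inr (Sum.inl ()), n) (Sum.inr (Sum.inl ()), 0) := by
        intro n
        induction n with
        | zero => exact fun _ => .refl
        | succ n ih =>
          intro hn
          refine .head (Or.inr ⟨Or.inl ⟨?_, rfl⟩, rfl⟩) (ih (by omega))
          simp [tapeAt_succ w (show n < w.length by omega)]
      have h4 : (A.inter B).Step w (Sum.inr (Sum.inl ()), 0) (Sum.inr (Sum.inr B.start), 1) :=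
        Or.inl ⟨Or.inr ⟨rfl, rfl⟩, rfl⟩
      have h5 : Relation.ReflTransGen ((A.inter B).Step w) (Sum.inr (Sum.inr B.start), 1)
          (Sum.inr (Sum.inr qB), w.length + 1) := by
        refine Relation.ReflTransGen.lift (fun c : Q₂ × ℕ => (Sum.inr (Sum.inr c.1), c.2)) ?_ _ _ hrB
        rintro c c' (⟨h, h'⟩ | ⟨h, h'⟩)
        · exact Or.inl ⟨⟨c'.1, rfl, h⟩, h'⟩
        · exact Or.inr ⟨⟨c'.1, rfl, h⟩, h'⟩
      exact ((h1.tail h2).trans (h3 _ le_rfl)).trans (.head h4 h5)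
    · ext ⟨p, d⟩
      simp [inter, hhB]

/-! ### Choice by the first letter -/

/-- Behave like `A` if the first letter satisfies `P`, and like `B` otherwise; accept the empty
word. -/
def choice (P : α → Prop) (A : TwoNFA α Q₁) (B : TwoNFA α Q₂) :
    TwoNFA α (Option (Q₁ ⊕ Q₂)) where
  δ
    | none, TapeSymbol.letter a =>
        {p | (P a ∧ ∃ q', p.1 = some (Sum.inl q') ∧
            (q', p.2) ∈ A.δ A.start (TapeSymbol.letter a)) ∨
          (¬ P a ∧ ∃ q', p.1 = some (Sum.inr q') ∧
            (q', p.2) ∈ B.δ B.start (TapeSymbol.letter a))}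
    | none, _ => ∅
    | some (Sum.inl q), a => {p | ∃ q', p.1 = some (Sum.inl q') ∧ (q', p.2) ∈ A.δ q a}
    | some (Sum.inr q), a => {p | ∃ q', p.1 = some (Sum.inr q') ∧ (q', p.2) ∈ B.δ q a}
  start := none
  final := {p | p = none ∨ (∃ q ∈ A.final, p = some (Sum.inl q)) ∨
    ∃ q ∈ B.final, p = some (Sum.inr q)}
  not_pass_left p q h := by
    rcases p with _ | p | p
    · simp at h
    · obtain ⟨q', -, h⟩ := h
      exact A.not_pass_left _ _ h
    · obtain ⟨q', -, h⟩ := h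
      exact B.not_pass_left _ _ h
  not_pass_right p q h := by
    rcases p with _ | p | p
    · simp at h
    · obtain ⟨q', -, h⟩ := h
      exact A.not_pass_right _ _ h
    · obtain ⟨q', -, h⟩ := h
      exact B.not_pass_right _ _ h

theorem choice_isDeterministic {P : α → Prop} {A : TwoNFA α Q₁} {B : TwoNFA α Q₂}
    (hA : A.IsDeterministic) (hB : B.IsDeterministic) : (choice P A B).IsDeterministic := by
  rintro (_ | q | q) a ⟨x, d⟩ hx ⟨y, e⟩ hy
  · cases a with
    | leftEnd => exact hx.elim
    | rightEnd => exact hx.elim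
    | letter a =>
      rcases hx with ⟨h, x', rfl, hx⟩ | ⟨h, x', rfl, hx⟩ <;>
        rcases hy with ⟨h', y', rfl, hy⟩ | ⟨h', y', rfl, hy⟩
      · have := hA _ _ hx hy
        simp_all
      · exact absurd h h'
      · exact absurd h' h
      · have := hB _ _ hx hy
        simp_all
  · obtain ⟨x', rfl, hx⟩ := hx
    obtain ⟨y', rfl, hy⟩ := hy
    have := hA _ _ hx hy
    simp_all
  · obtain ⟨x', rfl, hx⟩ := hx
    obtain ⟨y', rfl, hy⟩ := hy
    have := hB _ _ hx hy
    simp_all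

theorem choice_accepts_nil (P : α → Prop) (A : TwoNFA α Q₁) (B : TwoNFA α Q₂) :
    (choice P A B).Accepts [] :=
  accepts_iff.mpr ⟨none, Or.inl rfl, .refl, rfl⟩

theorem of_choice_accepts {P : α → Prop} {A : TwoNFA α Q₁} {B : TwoNFA α Q₂} {w : List α}
    (h : (choice P A B).Accepts w) : w = [] ∨ A.Accepts w ∨ B.Accepts w := by
  rw [accepts_iff] at h
  obtain ⟨q, hq, hr, hh⟩ := h
  have key : ∀ c, Relation.ReflTransGen ((choice P A B).Step w) (none, 1) c →
      (c.1 = none → c.2 = 1) ∧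
      (∀ q, c.1 = some (Sum.inl q) →
        Relation.ReflTransGen (A.Step w) (A.start, 1) (q, c.2)) ∧
      (∀ q, c.1 = some (Sum.inr q) →
        Relation.ReflTransGen (B.Step w) (B.start, 1) (q, c.2)) := by
    intro c hc
    induction hc with
    | refl => simp
    | @tail b c _ hs ih =>
      obtain ⟨ih0, ih1, ih2⟩ := ih
      obtain ⟨b, i⟩ := b
      obtain ⟨c, j⟩ := c
      rcases b with _ | q | q
      · obtain rfl : i = 1 := ih0 rfl
        simp only [Step] at hs
        generalize htape : tapeAt w 1 = t at hs
        cases t with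
        | leftEnd => rcases hs with ⟨h, -⟩ | ⟨h, -⟩ <;> exact h.elim
        | rightEnd => rcases hs with ⟨h, -⟩ | ⟨h, -⟩ <;> exact h.elim
        | letter a =>
          rcases hs with ⟨⟨-, q', hc, h⟩ | ⟨-, q', hc, h⟩, h'⟩ |
            ⟨⟨-, q', hc, h⟩ | ⟨-, q', hc, h⟩, h'⟩ <;> (simp only at hc; subst hc)
          · refine ⟨by simp, ?_, by simp⟩
            rintro _ ⟨⟩
            exact .single (Or.inl ⟨by simpa [htape] using h, h'⟩)
          · refine ⟨by simp, by simp, ?_⟩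
            rintro _ ⟨⟩
            exact .single (Or.inl ⟨by simpa [htape] using h, h'⟩)
          · refine ⟨by simp, ?_, by simp⟩
            rintro _ ⟨⟩
            exact .single (Or.inr ⟨by simpa [htape] using h, h'⟩)
          · refine ⟨by simp, by simp, ?_⟩
            rintro _ ⟨⟩
            exact .single (Or.inr ⟨by simpa [htape] using h, h'⟩)
      · have h1 := ih1 _ rfl
        rcases hs with ⟨⟨q', hc, h⟩, h'⟩ | ⟨⟨q', hc, h⟩, h'⟩ <;> (simp only at hc; subst hc)
        · refine ⟨by simp, ?_, by simp⟩
          rintro _ ⟨⟩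
          exact h1.tail (Or.inl ⟨h, h'⟩)
        · refine ⟨by simp, ?_, by simp⟩
          rintro _ ⟨⟩
          exact h1.tail (Or.inr ⟨h, h'⟩)
      · have h1 := ih2 _ rfl
        rcases hs with ⟨⟨q', hc, h⟩, h'⟩ | ⟨⟨q', hc, h⟩, h'⟩ <;> (simp only at hc; subst hc)
        · refine ⟨by simp, by simp, ?_⟩
          rintro _ ⟨⟩
          exact h1.tail (Or.inl ⟨h, h'⟩)
        · refine ⟨by simp, by simp, ?_⟩
          rintro _ ⟨⟩
          exact h1.tail (Or.inr ⟨h, h'⟩)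
  obtain ⟨h0, h1, h2⟩ := key _ hr
  rcases hq with rfl | ⟨q, hq, rfl⟩ | ⟨q, hq, rfl⟩
  · left
    simpa using h0 rfl
  · right; left
    refine accepts_iff.mpr ⟨q, hq, h1 _ rfl, ?_⟩
    ext p
    simp only [Set.mem_empty_iff_false, iff_false]
    intro hp
    have : ((some (Sum.inl p.1), p.2) : Option (Q₁ ⊕ Q₂) × HeadMove) ∈
        (choice P A B).δ (some (Sum.inl q)) TapeSymbol.rightEnd := ⟨p.1, rfl, hp⟩
    simp [hh] at this
  · right; right
    refine accepts_iff.mpr ⟨q, hq, h2 _ rfl, ?_⟩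
    ext p
    simp only [Set.mem_empty_iff_false, iff_false]
    intro hp
    have : ((some (Sum.inr p.1), p.2) : Option (Q₁ ⊕ Q₂) × HeadMove) ∈
        (choice P A B).δ (some (Sum.inr q)) TapeSymbol.rightEnd := ⟨p.1, rfl, hp⟩
    simp [hh] at this

theorem choice_accepts_left {P : α → Prop} {A : TwoNFA α Q₁} {B : TwoNFA α Q₂} {a : α}
    {w : List α} (ha : P a) (h : A.Accepts (a :: w)) : (choice P A B).Accepts (a :: w) := by
  rw [accepts_iff] at h ⊢
  obtain ⟨q, hq, hr, hh⟩ := h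
  refine ⟨_, Or.inr (Or.inl ⟨q, hq, rfl⟩), ?_, ?_⟩
  · rcases hr.cases_head with h | ⟨c, hc, hr⟩
    · simp at h
    · refine .head (b := (some (Sum.inl c.1), c.2)) ?_ ?_
      · rcases hc with ⟨h, h'⟩ | ⟨h, h'⟩
        · exact Or.inl ⟨Or.inl ⟨ha, c.1, rfl, h⟩, h'⟩
        · exact Or.inr ⟨Or.inl ⟨ha, c.1, rfl, h⟩, h'⟩
      · refine Relation.ReflTransGen.lift
          (fun c : Q₁ × ℕ => ((some (Sum.inl c.1) : Option (Q₁ ⊕ Q₂)), c.2)) ?_ _ _ hr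
        rintro c c' (⟨h, h'⟩ | ⟨h, h'⟩)
        · exact Or.inl ⟨⟨c'.1, rfl, h⟩, h'⟩
        · exact Or.inr ⟨⟨c'.1, rfl, h⟩, h'⟩
  · ext ⟨p, d⟩
    simp [choice, hh]

theorem choice_accepts_right {P : α → Prop} {A : TwoNFA α Q₁} {B : TwoNFA α Q₂} {a : α}
    {w : List α} (ha : ¬ P a) (h : B.Accepts (a :: w)) : (choice P A B).Accepts (a :: w) := by
  rw [accepts_iff] at h ⊢
  obtain ⟨q, hq, hr, hh⟩ := h
  refine ⟨_, Or.inr (Or.inr ⟨q, hq, rfl⟩), ?_, ?_⟩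
  · rcases hr.cases_head with h | ⟨c, hc, hr⟩
    · simp at h
    · refine .head (b := (some (Sum.inr c.1), c.2)) ?_ ?_
      · rcases hc with ⟨h, h'⟩ | ⟨h, h'⟩
        · exact Or.inl ⟨Or.inr ⟨ha, c.1, rfl, h⟩, h'⟩
        · exact Or.inr ⟨Or.inr ⟨ha, c.1, rfl, h⟩, h'⟩
      · refine Relation.ReflTransGen.lift
          (fun c : Q₂ × ℕ => ((some (Sum.inr c.1) : Option (Q₁ ⊕ Q₂)), c.2)) ?_ _ _ hr
        rintro c c' (⟨h, h'⟩ | ⟨h, h'⟩)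
        · exact Or.inl ⟨⟨c'.1, rfl, h⟩, h'⟩
        · exact Or.inr ⟨⟨c'.1, rfl, h⟩, h'⟩
  · ext ⟨p, d⟩
    simp [choice, hh]

end TwoNFA

namespace TwoNFA

variable {α S : Type}

theorem FunStep.forward {F : Finset S} {f : S → TapeSymbol α → Option (S × HeadMove)} {w : List α}
    {q q' : S} {i : ℕ} (hi : i < w.length) (hq : q' ∈ F)
    (h : f q (TapeSymbol.letter w[i]) = some (q', HeadMove.forward)) :
    FunStep F f w (q, i + 1) (q', i + 2) :=
  ⟨hq, Or.inl ⟨by rw [tapeAt_succ w hi, h], rfl, hi⟩⟩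

theorem FunStep.backward {F : Finset S} {f : S → TapeSymbol α → Option (S × HeadMove)} {w : List α}
    {q q' : S} {i : ℕ} (hi : i < w.length) (hq : q' ∈ F)
    (h : f q (TapeSymbol.letter w[i]) = some (q', HeadMove.backward)) :
    FunStep F f w (q, i + 1) (q', i) :=
  ⟨hq, Or.inr ⟨by rw [tapeAt_succ w hi, h], rfl⟩⟩

theorem FunStep.leftEnd {F : Finset S} {f : S → TapeSymbol α → Option (S × HeadMove)} {w : List α}
    {q q' : S} (hq : q' ∈ F) (h : f q TapeSymbol.leftEnd = some (q', HeadMove.forward)) :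
    FunStep F f w (q, 0) (q', 1) :=
  ⟨hq, Or.inl ⟨h, rfl, Nat.zero_le _⟩⟩

/-! ### Comparing the gaps between consecutive marked letters -/

/-- States of the automaton that checks that consecutive marked letters are at the same distance:
`seek` looks for the first mark, `up c` measures a gap while moving backward, `hold c` moves to the
end of the gap of length `c`, `test c` has just left it, `down c` expects a mark after
`c - 1` unmarked letters. -/
inductive GapState : Type
  | seek
  | up (c : ℕ)
  | hold (c : ℕ)
  | test (c : ℕ)
  | down (c : ℕ)

open Classical in
/-- The states with counters at most `N`. -/
noncomputable def gapStates (N : ℕ) : Finset GapState :=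
  {GapState.seek} ∪ (Finset.range (N + 1)).image GapState.up ∪
    (Finset.range (N + 1)).image GapState.hold ∪ (Finset.range (N + 1)).image GapState.test ∪
    (Finset.range (N + 1)).image GapState.down

theorem card_gapStates_le (N : ℕ) : (gapStates N).card ≤ 4 * N + 5 := by
  classical
  have h (g : ℕ → GapState) : ((Finset.range (N + 1)).image g).card ≤ N + 1 :=
    Finset.card_image_le.trans (by simp)
  unfold gapStates
  refine (Finset.card_union_le _ _).trans ?_
  have h1 := h GapState.down
  refine (Nat.add_le_add_right (Finset.card_union_le _ _) _).trans ?_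
  have h2 := h GapState.test
  refine (Nat.add_le_add_right (Nat.add_le_add_right (Finset.card_union_le _ _) _) _).trans ?_
  have h3 := h GapState.hold
  refine (Nat.add_le_add_right (Nat.add_le_add_right (Nat.add_le_add_right
    (Finset.card_union_le _ _) _) _) _).trans ?_
  have h4 := h GapState.up
  have h5 : ({GapState.seek} : Finset GapState).card = 1 := Finset.card_singleton _
  omega

theorem seek_mem_gapStates (N : ℕ) : GapState.seek ∈ gapStates N := by simp [gapStates]

theorem up_mem_gapStates {N c : ℕ} : GapState.up c ∈ gapStates N ↔ c ≤ N := by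
  simp [gapStates]

theorem hold_mem_gapStates {N c : ℕ} : GapState.hold c ∈ gapStates N ↔ c ≤ N := by
  simp [gapStates]

theorem test_mem_gapStates {N c : ℕ} : GapState.test c ∈ gapStates N ↔ c ≤ N := by
  simp [gapStates]

theorem down_mem_gapStates {N c : ℕ} : GapState.down c ∈ gapStates N ↔ c ≤ N := by
  simp [gapStates]

/-- Moves of the gap comparing automaton, where `mark` tells which letters are marked. -/
def gapMove (mark : α → Bool) : GapState → TapeSymbol α → Option (GapState × HeadMove)
  | .seek, .letter a =>
      if mark a then some (.up 1, .backward) else some (.seek, .forward)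
  | .up c, .letter a =>
      if mark a then (if 2 ≤ c then some (.hold c, .forward) else none)
      else some (.up (c + 1), .backward)
  | .up c, .leftEnd => if 2 ≤ c then some (.hold c, .forward) else none
  | .hold c, .letter a => if mark a then some (.test c, .forward) else some (.hold c, .forward)
  | .test c, .letter a => if mark a then none else some (.down (c - 1), .forward)
  | .down c, .letter a =>
      if c = 1 then (if mark a then some (.up 1, .backward) else none)
      else (if mark a then none else some (.down (c - 1), .forward))
  | _, _ => none

/-- The automaton that checks that marks occur periodically, with a period `d` such that
`2 ≤ d ≤ N`, and that the last letter is marked. -/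
noncomputable def gapAutomaton (mark : α → Bool) (N : ℕ) : TwoNFA α (gapStates N) :=
  ofFun (gapStates N) (gapMove mark) ⟨GapState.seek, seek_mem_gapStates N⟩
    {q | ∃ c, q = GapState.test c}

theorem exists_dvd_of_gapAutomaton_accepts {mark : α → Bool} {N : ℕ} {w : List α}
    (h : (gapAutomaton mark N).Accepts w) : ∃ d, 2 ≤ d ∧ d ≤ N ∧ d ∣ w.length := by
  let Mk : ℕ → Prop := fun p => ∃ a, tapeAt w p = TapeSymbol.letter a ∧ mark a = true
  let I : GapState → ℕ → Prop := fun q p => match q with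
    | .seek => 1 ≤ p ∧ ∀ x, 1 ≤ x → x < p → ¬ Mk x
    | .up c => 1 ≤ c ∧ ∃ r a, (a = 0 ∨ Mk a) ∧ r ∣ a ∧ (∀ x, a < x → x < a + r → ¬ Mk x) ∧
        Mk (a + r) ∧ p + c = a + r ∧ a ≤ p
    | .hold c => 2 ≤ c ∧ ∃ a, c ∣ a ∧ (∀ x, a < x → x < a + c → ¬ Mk x) ∧ Mk (a + c) ∧
        a < p ∧ p ≤ a + c
    | .test c => 2 ≤ c ∧ ∃ a, Mk a ∧ c ∣ a ∧ p = a + 1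
    | .down c => 1 ≤ c ∧ ∃ r a, Mk a ∧ 2 ≤ r ∧ r ∣ a ∧ (∀ x, a < x → x < p → ¬ Mk x) ∧
        p + c = a + r + 1 ∧ a < p
  have key := exists_of_ofFun_accepts (F := gapStates N) (f := gapMove mark)
    (s₀ := ⟨GapState.seek, seek_mem_gapStates N⟩) (acc := {q | ∃ c, q = GapState.test c})
    (w := w) I ⟨le_rfl, fun x h1 h2 => by omega⟩ ?_ ?_ h
  · obtain ⟨_, hq, ⟨c, rfl⟩, h2, a, -, hca, ha⟩ := key
    refine ⟨c, h2, test_mem_gapStates.mp hq, ?_⟩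
    rwa [Nat.add_right_cancel ha]
  · intro q q' p _ _ _ hI hf
    cases htape : tapeAt w p with
    | rightEnd => rw [htape] at hf; cases q <;> simp [gapMove] at hf
    | leftEnd =>
      have hp : p = 0 := by
        cases p with
        | zero => rfl
        | succ p =>
          by_cases hi : p < w.length
          · simp [tapeAt_succ w hi] at htape
          · simp [tapeAt, List.getElem?_eq_none (not_lt.mp hi)] at htape
      subst hp
      rw [htape] at hf
      cases q with
      | up c =>
        obtain ⟨h1, r, a, -, hra, hx, hm, hpc, hap⟩ := hI
        obtain rfl : a = 0 := by omega
        obtain rfl : c = r := by omega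
        simp only [gapMove] at hf
        split_ifs at hf with h2
        simp only [Option.some.injEq, Prod.mk.injEq, and_true] at hf
        subst hf
        exact ⟨h2, 0, hra, hx, hm, by omega, by omega⟩
      | _ => simp [gapMove] at hf
    | letter a =>
      rw [htape] at hf
      have hMk : Mk p ↔ mark a = true := by simp [Mk, htape]
      cases q with
      | seek =>
        simp only [gapMove] at hf
        split_ifs at hf with h1 <;> simp at hf
        subst hf
        refine ⟨by omega, fun x hx hxp => ?_⟩
        rcases Nat.lt_succ_iff_lt_or_eq.mp hxp with hlt | rfl
        · exact hI.2 x hx hlt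
        · rwa [hMk]
      | up c =>
        obtain ⟨h1, r, b, -, hra, hx, hm, hpc, hap⟩ := hI
        simp only [gapMove] at hf
        split_ifs at hf with h2 h3 <;> simp at hf
        subst hf
        obtain rfl : b = p := by
          by_contra hne
          exact hx p (by omega) (by omega) (hMk.mpr h2)
        obtain rfl : c = r := by omega
        exact ⟨h3, b, hra, hx, hm, by omega, by omega⟩
      | hold c =>
        obtain ⟨h1, b, hra, hx, hm, hap, hpc⟩ := hI
        simp only [gapMove] at hf
        split_ifs at hf with h2 <;> simp at hf <;> subst hf
        · have hp : p = b + c := by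
            by_contra hne
            exact hx p (by omega) (by omega) (hMk.mpr h2)
          exact ⟨h1, b + c, hm, (Nat.dvd_add_right hra).mpr dvd_rfl, by omega⟩
        · have hp : p ≠ b + c := by
            rintro rfl
            exact h2 (hMk.mp hm)
          exact ⟨h1, b, hra, hx, hm, by omega, by omega⟩
      | test c =>
        obtain ⟨h1, b, hb, hra, rfl⟩ := hI
        simp only [gapMove] at hf
        split_ifs at hf with h2
        simp at hf
        subst hf
        refine ⟨by omega, c, b, hb, h1, hra, fun x hx1 hx2 => ?_, by omega, by omega⟩
        obtain rfl : x = b + 1 := by omega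
        rwa [hMk]
      | down c =>
        obtain ⟨h1, r, b, hb, h2, hra, hx, hpc, hap⟩ := hI
        simp only [gapMove] at hf
        split_ifs at hf with h3 h4 h4 <;> simp at hf
        subst hf
        refine ⟨by omega, r, b, hb, h2, hra, fun x hx1 hx2 => ?_, by omega, by omega⟩
        rcases Nat.lt_succ_iff_lt_or_eq.mp hx2 with hlt | rfl
        · exact hx x hx1 hlt
        · rwa [hMk]
  · intro q q' p _ _ _ hI hf
    cases htape : tapeAt w (p + 1) with
    | rightEnd => rw [htape] at hf; cases q <;> simp [gapMove] at hf
    | leftEnd => rw [htape] at hf; cases q <;> simp [gapMove] at hf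
    | letter a =>
      rw [htape] at hf
      have hMk : Mk (p + 1) ↔ mark a = true := by simp [Mk, htape]
      cases q with
      | seek =>
        simp only [gapMove] at hf
        split_ifs at hf with h1 <;> simp at hf
        subst hf
        refine ⟨le_rfl, p + 1, 0, Or.inl rfl, dvd_zero _, fun x hx1 hx2 => hI.2 x hx1 (by omega), ?_, by omega,
          by omega⟩
        rw [zero_add]
        exact hMk.mpr h1
      | up c =>
        obtain ⟨h1, r, b, hb, hra, hx, hm, hpc, hap⟩ := hI
        simp only [gapMove] at hf
        split_ifs at hf with h2 h3 <;> simp at hf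
        subst hf
        have hne : b ≠ p + 1 := by
          rintro rfl
          exact h2 (hMk.mp (hb.resolve_left (by omega)))
        exact ⟨by omega, r, b, hb, hra, hx, hm, by omega, by omega⟩
      | hold c =>
        simp only [gapMove] at hf
        split_ifs at hf <;> simp at hf
      | test c =>
        simp only [gapMove] at hf
        split_ifs at hf
        simp at hf
      | down c =>
        obtain ⟨h1, r, b, hb, h2, hra, hx, hpc, hap⟩ := hI
        simp only [gapMove] at hf
        split_ifs at hf with h3 h4 h4 <;> simp at hf
        subst hf
        refine ⟨le_rfl, r, b, Or.inr hb, hra, fun x hx1 hx2 => hx x hx1 (by omega), ?_, by omega, by omega⟩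
        rw [show b + r = p + 1 by omega]
        exact hMk.mpr h4

theorem gapAutomaton_accepts {mark : α → Bool} {N d k : ℕ} {w : List α} (hd : 2 ≤ d) (hN : d ≤ N)
    (hk : 1 ≤ k) (hw : w.length = k * d)
    (hm : ∀ (i : ℕ) (hi : i < w.length), mark w[i] = true ↔ d ∣ i + 1) :
    (gapAutomaton mark N).Accepts w := by
  let R := Relation.ReflTransGen (FunStep (gapStates N) (gapMove mark) w)
  have hnd : ∀ j i, j * d < i + 1 → i + 1 < j * d + d → ¬ d ∣ i + 1 := by
    rintro j i h1 h2 ⟨e, he⟩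
    rw [he] at h1 h2
    have h3 : j < e := by nlinarith
    have h4 : e < j + 1 := by nlinarith
    omega
  have hlen : ∀ j < k, j * d + d ≤ w.length := by
    intro j hj
    rw [hw]
    nlinarith
  have hseek : ∀ i, i < d → R (.seek, 1) (.seek, i + 1) := by
    intro i
    induction i with
    | zero => exact fun _ => .refl
    | succ i ih =>
      intro hi
      have h1 := hlen 0 hk
      refine (ih (by omega)).tail
        (FunStep.forward (by omega) (seek_mem_gapStates N) ?_)
      have := (hm i (by omega)).not.mpr (hnd 0 i (by omega) (by omega))
      simp [gapMove, this]
  have hup : ∀ j < k, ∀ c, c < d → R (.up 1, j * d + d - 1) (.up (c + 1), j * d + d - 1 - c) := by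
    intro j hj c
    induction c with
    | zero => exact fun _ => .refl
    | succ c ih =>
      intro hc
      have h1 := hlen j hj
      refine (ih (by omega)).tail ?_
      have h2 : j * d + d - 1 - c = (j * d + d - 1 - (c + 1)) + 1 := by omega
      rw [h2]
      refine FunStep.backward (by omega) (up_mem_gapStates.mpr (by omega)) ?_
      have := (hm (j * d + d - 1 - (c + 1)) (by omega)).not.mpr (hnd j _ (by omega) (by omega))
      simp [gapMove, this]
  have hturn : ∀ j < k, FunStep (gapStates N) (gapMove mark) w (.up d, j * d)
      (.hold d, j * d + 1) := by
    intro j hj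
    rcases j with _ | j
    · rw [zero_mul]
      exact FunStep.leftEnd (hold_mem_gapStates.mpr hN) (by simp [gapMove, hd])
    · have h1 := hlen _ hj
      have h2 : (j + 1) * d = ((j + 1) * d - 1) + 1 := by
        have : 0 < (j + 1) * d := by positivity
        omega
      rw [h2]
      refine FunStep.forward (by omega) (hold_mem_gapStates.mpr hN) ?_
      have := (hm ((j + 1) * d - 1) (by omega)).mpr (by rw [← h2]; exact dvd_mul_left _ _)
      simp [gapMove, this, hd]
  have hhold : ∀ j < k, ∀ i, i < d → R (.hold d, j * d + 1) (.hold d, j * d + i + 1) := by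
    intro j hj i
    induction i with
    | zero => exact fun _ => .refl
    | succ i ih =>
      intro hi
      have h1 := hlen j hj
      refine (ih (by omega)).tail
        (FunStep.forward (by omega) (hold_mem_gapStates.mpr hN) ?_)
      have := (hm (j * d + i) (by omega)).not.mpr (hnd j _ (by omega) (by omega))
      simp [gapMove, this]
  have hround : ∀ j < k, R (.up 1, j * d + d - 1) (.test d, (j + 1) * d + 1) := by
    intro j hj
    have h1 := hup j hj (d - 1) (by omega)
    rw [show d - 1 + 1 = d by omega, show j * d + d - 1 - (d - 1) = j * d by omega] at h1
    have h2 := (h1.tail (hturn j hj)).trans (hhold j hj (d - 1) (by omega))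
    have h3 := hlen j hj
    refine h2.tail ?_
    rw [show (j + 1) * d + 1 = j * d + (d - 1) + 2 by rw [Nat.succ_mul]; omega]
    refine FunStep.forward (by omega) (test_mem_gapStates.mpr hN) ?_
    have := (hm (j * d + (d - 1)) (by omega)).mpr
      (by rw [show j * d + (d - 1) + 1 = (j + 1) * d by rw [Nat.succ_mul]; omega]
          exact dvd_mul_left _ _)
    simp [gapMove, this]
  have hdown : ∀ j < k, ∀ i, i + 1 < d →
      R (.test d, j * d + 1) (.down (d - 1 - i), j * d + i + 2) := by
    intro j hj i
    have h1 := hlen j hj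
    induction i with
    | zero =>
      intro hi
      refine .single (FunStep.forward (i := j * d) (by omega)
        (down_mem_gapStates.mpr (by omega)) ?_)
      have := (hm (j * d) (by omega)).not.mpr (hnd j _ (by omega) (by omega))
      simp [gapMove, this]
    | succ i ih =>
      intro hi
      refine (ih (by omega)).tail (FunStep.forward (i := j * d + i + 1) (by omega)
        (down_mem_gapStates.mpr (by omega)) ?_)
      have := (hm (j * d + i + 1) (by omega)).not.mpr (hnd j _ (by omega) (by omega))
      have h2 : d - 1 - i ≠ 1 := by omega
      simp [gapMove, this, h2]
      omega
  have hback : ∀ j < k, R (.test d, j * d + 1) (.up 1, j * d + d - 1) := by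
    intro j hj
    have h1 := hlen j hj
    have h2 := hdown j hj (d - 2) (by omega)
    refine h2.tail ?_
    rw [show j * d + (d - 2) + 2 = (j * d + d - 1) + 1 by omega, show d - 1 - (d - 2) = 1 by omega]
    refine FunStep.backward (by omega) (up_mem_gapStates.mpr (by omega)) ?_
    have := (hm (j * d + d - 1) (by omega)).mpr
      (by rw [show j * d + d - 1 + 1 = (j + 1) * d by rw [Nat.succ_mul]; omega]
          exact dvd_mul_left _ _)
    simp [gapMove, this]
  have hfirst : R (.seek, 1) (.up 1, 0 * d + d - 1) := by
    have h1 := hlen 0 hk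
    refine (hseek (d - 1) (by omega)).tail ?_
    rw [show 0 * d + d - 1 = d - 1 by omega]
    refine FunStep.backward (by omega) (up_mem_gapStates.mpr (by omega)) ?_
    have := (hm (d - 1) (by omega)).mpr (by rw [show d - 1 + 1 = d by omega])
    simp [gapMove, this]
  have hall : ∀ j < k, R (.seek, 1) (.test d, (j + 1) * d + 1) := by
    intro j
    induction j with
    | zero => exact fun hj => hfirst.trans (hround 0 hj)
    | succ j ih => exact fun hj => ((ih (by omega)).trans (hback _ hj)).trans (hround _ hj)
  have h1 := hall (k - 1) (by omega)
  rw [show k - 1 + 1 = k by omega, ← hw] at h1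
  exact ofFun_accepts_of_run h1 ⟨d, rfl⟩ rfl

end TwoNFA

namespace TwoNFA

variable {α : Type}

/-! ### Comparing letters at a fixed distance -/

/-- States of the automaton that compares letters at a fixed distance: it stands at an odd position
in state `skip` and at an even one in state `read`; then `carry a t` brings the letter `a` forward
and `back t` returns. -/
inductive ShiftState (α : Type) : Type
  | skip
  | read
  | carry (a : α) (t : ℕ)
  | back (t : ℕ)

open Classical in
/-- The states with counters at most `N`. -/
noncomputable def shiftStates (α : Type) [Fintype α] (N : ℕ) : Finset (ShiftState α) :=
  {ShiftState.skip, ShiftState.read} ∪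
    (Finset.univ ×ˢ Finset.range (N + 1)).image (fun p => ShiftState.carry p.1 p.2) ∪
    (Finset.range (N + 1)).image ShiftState.back

section

variable [Fintype α]

theorem card_shiftStates_le (N : ℕ) :
    (shiftStates α N).card ≤ (Fintype.card α + 1) * (N + 1) + 2 := by
  classical
  unfold shiftStates
  refine (Finset.card_union_le _ _).trans ?_
  refine (Nat.add_le_add_right (Finset.card_union_le _ _) _).trans ?_
  have h1 : ((Finset.range (N + 1)).image (ShiftState.back (α := α))).card ≤ N + 1 :=
    Finset.card_image_le.trans (by simp)
  have h2 : ((Finset.univ ×ˢ Finset.range (N + 1)).image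
      (fun p : α × ℕ => ShiftState.carry p.1 p.2)).card ≤ Fintype.card α * (N + 1) :=
    Finset.card_image_le.trans (by simp)
  have h3 : ({ShiftState.skip, ShiftState.read} : Finset (ShiftState α)).card ≤ 2 :=
    Finset.card_le_two
  rw [Nat.add_mul]
  omega

theorem skip_mem_shiftStates (N : ℕ) : ShiftState.skip ∈ shiftStates α N := by simp [shiftStates]

theorem read_mem_shiftStates (N : ℕ) : ShiftState.read ∈ shiftStates α N := by simp [shiftStates]

theorem carry_mem_shiftStates {N t : ℕ} {a : α} :
    ShiftState.carry a t ∈ shiftStates α N ↔ t ≤ N := by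
  simp [shiftStates]

theorem back_mem_shiftStates {N t : ℕ} : ShiftState.back t ∈ shiftStates α N ↔ t ≤ N := by
  simp [shiftStates]

end

variable [DecidableEq α]

/-- Moves of the automaton that compares letters at distance `N`. -/
def shiftMove (N : ℕ) : ShiftState α → TapeSymbol α → Option (ShiftState α × HeadMove)
  | .skip, .letter _ => some (.read, .forward)
  | .read, .letter a => some (.carry a 1, .forward)
  | .carry a t, .letter b =>
      if t = N then (if a = b then some (.back 1, .backward) else none)
      else some (.carry a (t + 1), .forward)
  | .back t, .letter _ =>
      if t = N then some (.skip, .forward) else some (.back (t + 1), .backward)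
  | _, _ => none

variable [Fintype α]

/-- The automaton that checks that every letter at an even position equals the letter at distance
`N` to its right, if any. -/
noncomputable def shiftAutomaton (α : Type) [DecidableEq α] [Fintype α] (N : ℕ) :
    TwoNFA α (shiftStates α N) :=
  ofFun (shiftStates α N) (shiftMove N) ⟨ShiftState.skip, skip_mem_shiftStates N⟩
    {q | ∀ t, q ≠ ShiftState.back t}

theorem eq_of_shiftAutomaton_accepts {N : ℕ} (hN : 1 ≤ N) {w : List α}
    (h : (shiftAutomaton α N).Accepts w) (i : ℕ) (hi : i + N < w.length) (hodd : i % 2 = 1) :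
    w[i + N] = w[i] := by
  let G : ℕ → Prop := fun p => p % 2 = 0 → 1 ≤ p → p + N ≤ w.length → tapeAt w (p + N) = tapeAt w p
  let I : ShiftState α → ℕ → Prop := fun q p => match q with
    | .skip => p % 2 = 1 ∧ ∀ x < p, G x
    | .read => p % 2 = 0 ∧ 1 ≤ p ∧ ∀ x < p, G x
    | .carry a t => 1 ≤ t ∧ t ≤ N ∧ ∃ p₀, p = p₀ + t ∧ 1 ≤ p₀ ∧ p₀ % 2 = 0 ∧
        tapeAt w p₀ = TapeSymbol.letter a ∧ ∀ x < p₀, G x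
    | .back t => t ≤ N ∧ ∃ p₀, p + t = p₀ + N ∧ 1 ≤ p₀ ∧ p₀ % 2 = 0 ∧ ∀ x < p₀ + 1, G x
  have key := exists_of_ofFun_accepts (F := shiftStates α N) (f := shiftMove N)
    (s₀ := ⟨ShiftState.skip, skip_mem_shiftStates N⟩) (acc := {q | ∀ t, q ≠ ShiftState.back t})
    (w := w) I ⟨rfl, fun x hx h0 h1 => by omega⟩ ?_ ?_ h
  · have hG : G (i + 1) := by
      obtain ⟨q, -, hacc, hq⟩ := key
      cases q with
      | skip => exact hq.2 _ (by omega)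
      | read => exact hq.2.2 _ (by omega)
      | back t => exact absurd rfl (hacc t)
      | carry a t =>
        obtain ⟨h1, h2, p₀, h3, -, -, -, h4⟩ := hq
        by_cases hlt : i + 1 < p₀
        · exact h4 _ hlt
        · intro _ _ h5
          omega
    have := hG (by omega) (by omega) (by omega)
    rw [show i + 1 + N = (i + N) + 1 by omega, tapeAt_succ w hi,
      tapeAt_succ w (by omega)] at this
    simpa using this
  · intro q q' p _ _ _ hI hf
    cases htape : tapeAt w p with
    | rightEnd => rw [htape] at hf; cases q <;> simp [shiftMove] at hf
    | leftEnd => rw [htape] at hf; cases q <;> simp [shiftMove] at hf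
    | letter b =>
      rw [htape] at hf
      cases q with
      | skip =>
        simp only [shiftMove, Option.some.injEq, Prod.mk.injEq, and_true] at hf
        subst hf
        obtain ⟨h1, h2⟩ := hI
        refine ⟨by omega, by omega, fun x hx => ?_⟩
        rcases Nat.lt_succ_iff_lt_or_eq.mp hx with hlt | rfl
        · exact h2 x hlt
        · intro h3
          omega
      | read =>
        simp only [shiftMove, Option.some.injEq, Prod.mk.injEq, and_true] at hf
        subst hf
        exact ⟨le_rfl, hN, p, rfl, hI.2.1, hI.1, htape, hI.2.2⟩
      | carry a t =>
        obtain ⟨h1, h2, p₀, rfl, h3, h4, h5, h6⟩ := hI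
        simp only [shiftMove] at hf
        split_ifs at hf with h7 h8 <;> simp at hf
        subst hf
        exact ⟨by omega, by omega, p₀, by omega, h3, h4, h5, h6⟩
      | back t =>
        obtain ⟨h1, p₀, h2, h3, h4, h5⟩ := hI
        simp only [shiftMove] at hf
        split_ifs at hf with h7 <;> simp at hf
        subst hf
        obtain rfl : p = p₀ := by omega
        exact ⟨by omega, h5⟩
  · intro q q' p _ hq' _ hI hf
    cases htape : tapeAt w (p + 1) with
    | rightEnd => rw [htape] at hf; cases q <;> simp [shiftMove] at hf
    | leftEnd => rw [htape] at hf; cases q <;> simp [shiftMove] at hf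
    | letter b =>
      rw [htape] at hf
      cases q with
      | skip => simp [shiftMove] at hf
      | read => simp [shiftMove] at hf
      | carry a t =>
        obtain ⟨h1, h2, p₀, h2', h3, h4, h5, h6⟩ := hI
        simp only [shiftMove] at hf
        split_ifs at hf with h7 h8 <;> simp at hf
        subst hf
        refine ⟨hN, p₀, by omega, h3, h4, fun x hx => ?_⟩
        rcases Nat.lt_succ_iff_lt_or_eq.mp hx with hlt | rfl
        · exact h6 x hlt
        · intro _ _ _
          rw [← h7, ← h2', htape, h5, h8]
      | back t =>
        obtain ⟨h1, p₀, h2, h3, h4, h5⟩ := hI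
        simp only [shiftMove] at hf
        split_ifs at hf with h7 <;> simp at hf
        subst hf
        exact ⟨by omega, p₀, by omega, h3, h4, h5⟩

theorem shiftAutomaton_accepts {N : ℕ} (hN : 1 ≤ N) {w : List α}
    (hw : ∀ (i : ℕ) (hi : i + N < w.length), i % 2 = 1 → w[i + N] = w[i]) :
    (shiftAutomaton α N).Accepts w := by
  let R := Relation.ReflTransGen (FunStep (shiftStates α N) (shiftMove N) w)
  have hcarry : ∀ i (hi : i < w.length), ∀ t, t < N → i + t < w.length →
      R (.read, i + 1) (.carry w[i] (t + 1), i + t + 2) := by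
    intro i hi t
    induction t with
    | zero =>
      intro _ _
      exact .single (FunStep.forward hi (carry_mem_shiftStates.mpr hN) rfl)
    | succ t ih =>
      intro ht hit
      refine (ih (by omega) (by omega)).tail (FunStep.forward (i := i + t + 1) (by omega)
        (carry_mem_shiftStates.mpr (by omega)) ?_)
      have : t + 1 ≠ N := by omega
      simp [shiftMove, this]
  have hback : ∀ i, i + N < w.length → ∀ t, t < N →
      R (.back 1, i + N) (.back (t + 1), i + N - t) := by
    intro i hi t
    induction t with
    | zero => exact fun _ => .refl
    | succ t ih =>
      intro ht
      refine (ih (by omega)).tail ?_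
      rw [show i + N - t = (i + N - (t + 1)) + 1 by omega]
      refine FunStep.backward (by omega) (back_mem_shiftStates.mpr (by omega)) ?_
      have : t + 1 ≠ N := by omega
      simp [shiftMove, this]
  have hround : ∀ i, i + N < w.length → i % 2 = 1 → R (.read, i + 1) (.skip, i + 2) := by
    intro i hi hodd
    have h1 := hcarry i (by omega) (N - 1) (by omega) (by omega)
    rw [show N - 1 + 1 = N by omega, show i + (N - 1) + 2 = i + N + 1 by omega] at h1
    have h2 : FunStep (shiftStates α N) (shiftMove N) w (.carry w[i] N, i + N + 1)
        (.back 1, i + N) := by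
      refine FunStep.backward hi (back_mem_shiftStates.mpr hN) ?_
      simp [shiftMove, hw i hi hodd]
    have h3 := hback i hi (N - 1) (by omega)
    rw [show N - 1 + 1 = N by omega, show i + N - (N - 1) = i + 1 by omega] at h3
    refine ((h1.tail h2).trans h3).tail
      (FunStep.forward (by omega) (skip_mem_shiftStates N) ?_)
    simp [shiftMove]
  have hmain : ∀ j, 2 * j ≤ w.length →
      (∃ a t, R (.skip, 1) (.carry a t, w.length + 1)) ∨ R (.skip, 1) (.skip, 2 * j + 1) := by
    intro j
    induction j with
    | zero => exact fun _ => Or.inr .refl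
    | succ j ih =>
      intro hj
      rcases ih (by omega) with h | h
      · exact Or.inl h
      · have h1 : R (.skip, 1) (.read, 2 * j + 1 + 1) :=
          h.tail (FunStep.forward (by omega) (read_mem_shiftStates N) rfl)
        by_cases hlt : 2 * j + 1 + N < w.length
        · exact Or.inr (h1.trans (hround _ hlt (by omega)))
        · have h2 := hcarry (2 * j + 1) (by omega) (w.length - (2 * j + 2)) (by omega) (by omega)
          rw [show 2 * j + 1 + (w.length - (2 * j + 2)) + 2 = w.length + 1 by omega] at h2
          exact Or.inl ⟨_, _, h1.trans h2⟩
  rcases hmain (w.length / 2) (by omega) with ⟨a, t, h⟩ | h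
  · exact ofFun_accepts_of_run h (fun t => by simp) rfl
  · rcases Nat.mod_two_eq_zero_or_one w.length with h2 | h2
    · rw [show 2 * (w.length / 2) = w.length by omega] at h
      exact ofFun_accepts_of_run h (fun t => by simp) rfl
    · have h3 : R (.skip, 1) (.read, w.length + 1) := by
        rw [show w.length + 1 = 2 * (w.length / 2) + 2 by omega]
        exact h.tail (FunStep.forward (by omega) (read_mem_shiftStates N) rfl)
      exact ofFun_accepts_of_run h3 (fun t => by simp) rfl

end TwoNFA

/-! ### Binary digits, most significant first -/

/-- The number whose binary digits are the first `j` values of `b`, most significant first. -/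
def digitVal (b : ℕ → Bool) : ℕ → ℕ
  | 0 => 0
  | j + 1 => 2 * digitVal b j + (b j).toNat

theorem digitVal_congr {b c : ℕ → Bool} {j : ℕ} (h : ∀ i < j, b i = c i) :
    digitVal b j = digitVal c j := by
  induction j with
  | zero => rfl
  | succ j ih => rw [digitVal, digitVal, ih fun i hi => h i (by omega), h j (by omega)]

theorem div_two_pow_eq (v r : ℕ) :
    v / 2 ^ r = 2 * (v / 2 ^ (r + 1)) + (v.testBit r).toNat := by
  rw [Nat.toNat_testBit, pow_succ, ← Nat.div_div_eq_div_mul]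
  omega

/-- Tape symbols of the annotated unary words: the unique letter and two annotation bits. -/
abbrev AnnotatedLetter : Type := Unit × Bool × Bool

/-! ### Rows

Words are cut into rows of length `2 * L + 2`. Ignoring its first two letters, a row contains the
binary digits of numbers `d` and `x` interleaved with those of `d` and `x'`. -/

/-- States of the automaton that checks rows: column, previous digit of `d`, whether `d` is to be
subtracted in this row, difference of the prefixes read so far, whether the digits of `x'` read so
far vanish, whether `x'` vanished in the previous row. -/
abbrev RowState : Type := ℕ × Bool × Bool × ℤ × Bool × Bool

/-- Moves of the automaton that checks `x + (2 * L + 2) = x'` or `x + (2 * L + 2) = x' + d` in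
every row. -/
def rowNext (L : ℕ) : RowState → AnnotatedLetter → Option RowState
  | (c, prev, b, δ, cur, last), a =>
    if c = 0 then some (1, false, a.2.2, 0, true, last)
    else if c = 1 then some (2, false, b, 0, true, last)
    else if c % 2 = 0 then
      some (c + 1, a.2.1, b, 2 * δ + (a.2.2.toNat : ℤ) + (((2 * L + 2).testBit (L - c / 2)).toNat : ℤ)
        - ((b && a.2.1).toNat : ℤ), cur, last)
    else if a.2.1 = prev then
      if c = 2 * L + 1 then
        if δ = (a.2.2.toNat : ℤ) then some (0, false, false, 0, true, cur && !a.2.2) else none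
      else some (c + 1, false, b, δ - (a.2.2.toNat : ℤ), cur && !a.2.2, last)
    else none

/-- The states of the automaton that checks rows. -/
noncomputable def rowStates (L : ℕ) : Finset RowState :=
  Finset.range (2 * L + 2) ×ˢ Finset.univ ×ˢ Finset.univ ×ˢ Finset.Icc (-4) 4 ×ˢ
    Finset.univ ×ˢ Finset.univ

theorem card_rowStates (L : ℕ) : (rowStates L).card = 144 * (2 * L + 2) := by
  simp [rowStates, Finset.card_product]
  ring

theorem rowNext_row {L : ℕ} (hL : 1 ≤ L) (hW : 2 * L + 2 < 2 ^ L) {s : ℕ → RowState}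
    {g : ℕ → AnnotatedLetter} {i : ℕ}
    (hs : ∀ t < 2 * L + 2, rowNext L (s (i + t)) (g (i + t)) = some (s (i + t + 1)))
    (h0 : (s i).1 = 0) :
    (s (i + (2 * L + 2))).1 = 0 ∧
    ((s (i + (2 * L + 2))).2.2.2.2.2 = true →
      digitVal (fun j => (g (i + (2 * j + 3))).2.2) L = 0) ∧
    (∀ j < L, (g (i + (2 * j + 3))).2.1 = (g (i + (2 * j + 2))).2.1) ∧
    ∃ b : Bool, digitVal (fun j => (g (i + (2 * j + 2))).2.2) L + (2 * L + 2) =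
      digitVal (fun j => (g (i + (2 * j + 3))).2.2) L +
        b.toNat * digitVal (fun j => (g (i + (2 * j + 2))).2.1) L := by
  obtain ⟨b, last, hb⟩ : ∃ b last, s (i + 2) = (2, false, b, 0, true, last) := by
    have h1 := hs 0 (by omega)
    have h2 := hs 1 (by omega)
    rcases hsi : s i with ⟨c, prev, b, δ, cur, last⟩
    rw [hsi] at h0
    simp only at h0
    subst h0
    simp only [add_zero, hsi, rowNext, if_true, Option.some.injEq] at h1
    rw [← h1] at h2
    simp only [rowNext, one_ne_zero, if_false, if_true, Option.some.injEq] at h2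
    exact ⟨_, _, h2.symm⟩
  set xA : ℕ → Bool := fun j => (g (i + (2 * j + 2))).2.2 with hxA
  set dA : ℕ → Bool := fun j => (g (i + (2 * j + 2))).2.1 with hdA
  set xB : ℕ → Bool := fun j => (g (i + (2 * j + 3))).2.2 with hxB
  set dB : ℕ → Bool := fun j => (g (i + (2 * j + 3))).2.1 with hdB
  have hmid : ∀ j < L, ∃ δ : ℤ, s (i + (2 * j + 3)) =
      (2 * j + 3, dA j, b, δ, decide (digitVal xB j = 0), last) ∧
      δ = digitVal xA (j + 1) + ((2 * L + 2) / 2 ^ (L - (j + 1)) : ℕ) - 2 * digitVal xB j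
        - b.toNat * digitVal dA (j + 1) ∧ ∀ k < j, dB k = dA k := by
    intro j
    induction j with
    | zero =>
      intro _
      have h1 := hs 2 (by omega)
      rw [hb] at h1
      simp only [rowNext, Nat.reduceMod, if_true, OfNat.ofNat_ne_zero, OfNat.ofNat_ne_one,
        if_false, Option.some.injEq] at h1
      refine ⟨_, h1.symm, ?_, by simp⟩
      have h2 := div_two_pow_eq (2 * L + 2) (L - 1)
      rw [show L - 1 + 1 = L by omega, Nat.div_eq_of_lt hW] at h2
      simp only [digitVal, hxA, hdA]
      rw [zero_add, h2]
      cases b <;> simp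
    | succ j ih =>
      intro hj
      obtain ⟨δ, h1, h2, h3⟩ := ih (by omega)
      have h4 := hs (2 * j + 3) (by omega)
      rw [h1] at h4
      have e1 : ¬ 2 * j + 3 = 0 := by omega
      have e2 : ¬ 2 * j + 3 = 1 := by omega
      have e3 : ¬ (2 * j + 3) % 2 = 0 := by omega
      have e4 : ¬ 2 * j + 3 = 2 * L + 1 := by omega
      simp only [rowNext, e1, e2, e3, e4, if_false] at h4
      split_ifs at h4 with h5
      simp only [Option.some.injEq] at h4
      have h6 := hs (2 * j + 4) (by omega)
      rw [show i + (2 * j + 4) = i + (2 * j + 3) + 1 by omega, ← h4] at h6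
      have e5 : ¬ 2 * j + 3 + 1 = 0 := by omega
      have e6 : ¬ 2 * j + 3 + 1 = 1 := by omega
      have e7 : (2 * j + 3 + 1) % 2 = 0 := by omega
      simp only [rowNext, e5, e6, e7, if_false, if_true, Option.some.injEq] at h6
      refine ⟨_, (h6.symm.trans ?_), rfl, ?_⟩
      · have e8 : L - (2 * j + 3 + 1) / 2 = L - (j + 1 + 1) := by omega
        have e9 := div_two_pow_eq (2 * L + 2) (L - (j + 1 + 1))
        rw [show L - (j + 1 + 1) + 1 = L - (j + 1) by omega] at e9
        rw [e8, e9, h2]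
        simp only [Prod.mk.injEq]
        refine ⟨by omega, rfl, trivial, ?_, ?_, trivial⟩
        · simp only [digitVal, hxA, hdA, hxB]
          rw [show i + (2 * (j + 1) + 2) = i + (2 * j + 3) + 1 by omega]
          cases b <;> simp <;> ring
        · simp only [digitVal, hxB]
          cases (g (i + (2 * j + 3))).2.2 <;> simp
      · intro k hk
        rcases Nat.lt_succ_iff_lt_or_eq.mp hk with hk | rfl
        · exact h3 k hk
        · exact h5
  obtain ⟨l, rfl⟩ : ∃ l, L = l + 1 := ⟨L - 1, by omega⟩
  obtain ⟨δ, h1, h2, h3⟩ := hmid l (by omega)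
  have h4 := hs (2 * l + 3) (by omega)
  have e1 : ¬ 2 * l + 3 = 0 := by omega
  have e2 : ¬ 2 * l + 3 = 1 := by omega
  have e3 : ¬ (2 * l + 3) % 2 = 0 := by omega
  have e4 : 2 * l + 3 = 2 * (l + 1) + 1 := by omega
  rw [h1, rowNext, if_neg e1, if_neg e2, if_neg e3] at h4
  split_ifs at h4 with h5 h6
  simp only [Option.some.injEq] at h4
  rw [show i + (2 * (l + 1) + 2) = i + (2 * l + 3) + 1 by omega, ← h4]
  refine ⟨rfl, ?_, ?_, b, ?_⟩
  · simp only [digitVal, hxB]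
    cases (g (i + (2 * l + 3))).2.2 <;> simp
  · intro k hk
    rcases Nat.lt_succ_iff_lt_or_eq.mp hk with hk | rfl
    · exact h3 k hk
    · exact h5
  · have h7 : digitVal xB (l + 1) = 2 * digitVal xB l + (g (i + (2 * l + 3))).2.2.toNat := rfl
    rw [h2] at h6
    simp only [Nat.sub_self, pow_zero, Nat.div_one] at h6
    rw [h7]
    zify
    push_cast at h6
    linarith

/-- The automaton that checks rows. -/
noncomputable def rowAutomaton (L : ℕ) : TwoNFA AnnotatedLetter (rowStates L) :=
  TwoNFA.oneWay (rowStates L) (rowNext L) ⟨(0, false, false, 0, true, false), by simp [rowStates]⟩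
    {q | q.2.2.2.2.2 = true}

theorem rowNext_col {L : ℕ} {q q' : RowState} {a : AnnotatedLetter}
    (h : rowNext L q a = some q') (hq : q.1 < 2 * L + 1) :
    q'.1 = q.1 + 1 ∧ q'.2.2.2.2.2 = q.2.2.2.2.2 := by
  obtain ⟨c, prev, b, δ, cur, last⟩ := q
  simp only at hq
  simp only [rowNext] at h
  split_ifs at h with h1 h2 h3 h4 h5 h6
  · simp only [Option.some.injEq] at h
    subst h
    simp [h1]
  · simp only [Option.some.injEq] at h
    subst h
    simp [h2]
  · simp only [Option.some.injEq] at h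
    subst h
    simp
  · omega
  · simp only [Option.some.injEq] at h
    subst h
    simp

theorem of_rowAutomaton_accepts {L : ℕ} (hL : 1 ≤ L) (hW : 2 * L + 2 < 2 ^ L)
    {w : List AnnotatedLetter} (h : (rowAutomaton L).Accepts w) {g : ℕ → AnnotatedLetter}
    (hg : ∀ (i : ℕ) (hi : i < w.length), g i = w[i]) :
    1 ≤ w.length / (2 * L + 2) ∧
    digitVal (fun j => (g ((2 * L + 2) * (w.length / (2 * L + 2) - 1) + (2 * j + 3))).2.2) L = 0 ∧
    ∀ r < w.length / (2 * L + 2),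
      (∀ j < L, (g ((2 * L + 2) * r + (2 * j + 3))).2.1 =
        (g ((2 * L + 2) * r + (2 * j + 2))).2.1) ∧
      ∃ b : Bool, digitVal (fun j => (g ((2 * L + 2) * r + (2 * j + 2))).2.2) L + (2 * L + 2) =
        digitVal (fun j => (g ((2 * L + 2) * r + (2 * j + 3))).2.2) L +
          b.toNat * digitVal (fun j => (g ((2 * L + 2) * r + (2 * j + 2))).2.1) L := by
  rw [rowAutomaton, TwoNFA.oneWay_accepts_iff] at h
  obtain ⟨s, h0, -, hs, hacc⟩ := h
  replace hs : ∀ i < w.length, rowNext L (s i) (g i) = some (s (i + 1)) := fun i hi => by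
    rw [hg i hi]
    exact hs i hi
  set W := 2 * L + 2 with hWdef
  set R := w.length / W with hR
  have hRW : W * R ≤ w.length := Nat.mul_div_le _ _
  have hrow : ∀ r < R, ∀ t < W, rowNext L (s (W * r + t)) (g (W * r + t)) =
      some (s (W * r + t + 1)) := by
    intro r hr t ht
    refine hs _ ?_
    have : W * (r + 1) ≤ W * R := Nat.mul_le_mul_left _ hr
    rw [Nat.mul_succ] at this
    omega
  have hcol : ∀ r ≤ R, (s (W * r)).1 = 0 := by
    intro r
    induction r with
    | zero => intro _; simp [h0]
    | succ r ih => intro hr; exact (rowNext_row hL hW (hrow r hr) (ih (by omega))).1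
  have htail : ∀ t, W * R + t ≤ w.length →
      (s (W * R + t)).1 = t ∧ (s (W * R + t)).2.2.2.2.2 = (s (W * R)).2.2.2.2.2 := by
    intro t
    induction t with
    | zero => exact fun _ => ⟨hcol R le_rfl, rfl⟩
    | succ t ih =>
      intro ht
      obtain ⟨ih1, ih2⟩ := ih (by omega)
      have h1 : w.length < W * R + W := by
        have := Nat.lt_mul_div_succ w.length (show 0 < W by omega)
        rwa [Nat.mul_succ] at this
      obtain ⟨h2, h3⟩ := rowNext_col (hs (W * R + t) (by omega)) (by omega)
      rw [ih1] at h2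
      exact ⟨h2, h3.trans ih2⟩
  have hlast : (s (W * R)).2.2.2.2.2 = true := by
    have h1 := (htail (w.length - W * R) (by omega)).2
    rw [show W * R + (w.length - W * R) = w.length by omega] at h1
    rw [← h1]
    exact hacc
  have hR1 : 1 ≤ R := by
    refine Nat.pos_of_ne_zero fun this => ?_
    rw [this, mul_zero, h0] at hlast
    simp at hlast
  refine ⟨hR1, ?_, fun r hr => (rowNext_row hL hW (hrow r hr) (hcol r hr.le)).2.2⟩
  have h1 := (rowNext_row hL hW (hrow (R - 1) (by omega)) (hcol _ (by omega))).2.1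
  apply h1
  rwa [← hWdef, ← Nat.mul_succ, show (R - 1).succ = R by omega]

/-- The letter in column `c` of row `r` of the annotation that encodes the number `d`, the numbers
`x r` and the choices `b r`. -/
def rowLetter (L d : ℕ) (x : ℕ → ℕ) (b : ℕ → Bool) (r c : ℕ) : AnnotatedLetter :=
  if c < 2 then ((), false, b (r + c))
  else ((), d.testBit (L - c / 2), (x (r + c % 2)).testBit (L - c / 2))

/-- The state of the row automaton in column `c` of row `r` of that annotation. -/
def rowRun (L d : ℕ) (x : ℕ → ℕ) (b : ℕ → Bool) (r c : ℕ) : RowState :=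
  if c = 0 then (0, false, false, 0, true, decide (1 ≤ r ∧ x r = 0))
  else if c = 1 then (1, false, b r, 0, true, decide (1 ≤ r ∧ x r = 0))
  else if c % 2 = 0 then
    (c, false, b r,
      (x r / 2 ^ (L + 1 - c / 2) : ℕ) + ((2 * L + 2) / 2 ^ (L + 1 - c / 2) : ℕ)
        - (x (r + 1) / 2 ^ (L + 1 - c / 2) : ℕ) - (b r).toNat * (d / 2 ^ (L + 1 - c / 2) : ℕ),
      decide (x (r + 1) / 2 ^ (L + 1 - c / 2) = 0), decide (1 ≤ r ∧ x r = 0))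
  else
    (c, d.testBit (L - c / 2), b r,
      (x r / 2 ^ (L - c / 2) : ℕ) + ((2 * L + 2) / 2 ^ (L - c / 2) : ℕ)
        - 2 * (x (r + 1) / 2 ^ (L + 1 - c / 2) : ℕ) - (b r).toNat * (d / 2 ^ (L - c / 2) : ℕ),
      decide (x (r + 1) / 2 ^ (L + 1 - c / 2) = 0), decide (1 ≤ r ∧ x r = 0))

theorem div_add_div_bounds {x y z t q : ℕ} (hq : 0 < q) (h : x + y = z + t) :
    x / q + y / q ≤ z / q + t / q + 1 ∧ z / q + t / q ≤ x / q + y / q + 1 := by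
  have aux : ∀ u v : ℕ, (u + v) / q ≤ u / q + v / q + 1 ∧ u / q + v / q ≤ (u + v) / q := by
    intro u v
    refine ⟨?_, Nat.div_add_div_le_add_div⟩
    rw [Nat.add_div hq]
    split_ifs <;> omega
  have h1 := aux x y
  have h2 := aux z t
  rw [h] at h1
  omega

section

variable {L d : ℕ} {x : ℕ → ℕ} {b : ℕ → Bool}

theorem rowRun_mem (hb : ∀ r, x r + (2 * L + 2) = x (r + 1) + (b r).toNat * d) (r : ℕ) {c : ℕ}
    (hc : c < 2 * L + 2) : rowRun L d x b r c ∈ rowStates L := by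
  have key : ∀ q, 0 < q → x r / q + (2 * L + 2) / q ≤ x (r + 1) / q + (b r).toNat * (d / q) + 1 ∧
      x (r + 1) / q + (b r).toNat * (d / q) ≤ x r / q + (2 * L + 2) / q + 1 := by
    intro q hq
    have h1 := div_add_div_bounds hq (hb r)
    rcases hbr : b r <;> rw [hbr] at h1 <;> simpa using h1
  unfold rowRun
  split_ifs with h1 h2 h3
  · simp only [rowStates, Finset.mem_product, Finset.mem_range, Finset.mem_univ, Finset.mem_Icc,
      and_true, true_and]
    omega
  · simp only [rowStates, Finset.mem_product, Finset.mem_range, Finset.mem_univ, Finset.mem_Icc,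
      and_true, true_and]
    omega
  · have h4 := key (2 ^ (L + 1 - c / 2)) (by positivity)
    simp only [rowStates, Finset.mem_product, Finset.mem_range, Finset.mem_univ, Finset.mem_Icc,
      and_true, true_and]
    zify at h4
    push_cast
    omega
  · have h4 := key (2 ^ (L - c / 2)) (by positivity)
    have h5 := div_two_pow_eq (x (r + 1)) (L - c / 2)
    rw [show L - c / 2 + 1 = L + 1 - c / 2 by omega] at h5
    have h6 := Bool.toNat_le ((x (r + 1)).testBit (L - c / 2))
    simp only [rowStates, Finset.mem_product, Finset.mem_range, Finset.mem_univ, Finset.mem_Icc,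
      and_true, true_and]
    zify at h4 h5 h6
    push_cast
    omega

theorem rowNext_rowRun (hW : 2 * L + 2 < 2 ^ L) (hd : d < 2 ^ L) (hx : ∀ r, x r < 2 ^ L) (r : ℕ)
    {c : ℕ} (hc : c < 2 * L + 1) :
    rowNext L (rowRun L d x b r c) (rowLetter L d x b r c) = some (rowRun L d x b r (c + 1)) := by
  by_cases h0 : c = 0
  · subst h0
    simp [rowRun, rowLetter, rowNext]
  by_cases h1 : c = 1
  · subst h1
    simp [rowRun, rowNext, Nat.div_eq_of_lt hW, Nat.div_eq_of_lt hd, Nat.div_eq_of_lt (hx _)]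
  have h2 : ¬ c < 2 := by omega
  have h3 : ¬ c + 1 = 0 := by omega
  have h4 : ¬ c + 1 = 1 := by omega
  have hmax : ¬ c = 2 * L + 1 := by omega
  rcases Nat.mod_two_eq_zero_or_one c with hmod | hmod
  · have h5 : ¬ (c + 1) % 2 = 0 := by omega
    have h6 : (c + 1) / 2 = c / 2 := by omega
    simp only [rowRun, h0, h1, h3, h4, if_false, hmod, if_true, h5, rowLetter, h2, rowNext, h6,
      add_zero, Option.some.injEq, Prod.mk.injEq, true_and, and_true]
    have e (v : ℕ) := div_two_pow_eq v (L - c / 2)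
    rw [show L - c / 2 + 1 = L + 1 - c / 2 by omega] at e
    rw [e (x r), e (2 * L + 2), e d]
    push_cast
    cases b r <;> simp <;> ring
  · have h5 : (c + 1) % 2 = 0 := by omega
    have h7 : L + 1 - (c + 1) / 2 = L - c / 2 := by omega
    have h8 : ¬ c % 2 = 0 := by omega
    rw [rowRun, if_neg h0, if_neg h1, if_neg h8, rowRun, if_neg h3, if_neg h4, if_pos h5,
      rowLetter, if_neg h2, rowNext, if_neg h0, if_neg h1, if_neg h8, if_pos rfl, if_neg hmax, h7,
      hmod]
    simp only [Option.some.injEq, Prod.mk.injEq, true_and, and_true]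
    have e (v : ℕ) := div_two_pow_eq v (L - c / 2)
    rw [show L - c / 2 + 1 = L + 1 - c / 2 by omega] at e
    rw [e (x (r + 1))]
    refine ⟨?_, ?_⟩
    · push_cast
      ring
    · cases (x (r + 1)).testBit (L - c / 2) <;> simp

theorem rowNext_rowRun_last (hL : 1 ≤ L)
    (hb : ∀ r, x r + (2 * L + 2) = x (r + 1) + (b r).toNat * d) (r : ℕ) :
    rowNext L (rowRun L d x b r (2 * L + 1)) (rowLetter L d x b r (2 * L + 1)) =
      some (rowRun L d x b (r + 1) 0) := by
  have h0 : ¬ 2 * L + 1 = 0 := by omega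
  have h1 : ¬ 2 * L + 1 = 1 := by omega
  have h2 : ¬ 2 * L + 1 < 2 := by omega
  have h3 : ¬ (2 * L + 1) % 2 = 0 := by omega
  have h4 : (2 * L + 1) % 2 = 1 := by omega
  have h5 : (2 * L + 1) / 2 = L := by omega
  have e := div_two_pow_eq (x (r + 1)) 0
  simp only [zero_add, pow_zero, Nat.div_one] at e
  have h6 := hb r
  rw [rowRun, if_neg h0, if_neg h1, if_neg h3, rowRun, if_pos rfl, rowLetter, if_neg h2, rowNext,
    if_neg h0, if_neg h1, if_neg h3, if_pos rfl, if_pos rfl, h4, h5]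
  simp only [Nat.sub_self, pow_zero, Nat.div_one, Nat.add_sub_cancel_left, pow_one]
  rw [if_pos]
  · simp only [Option.some.injEq, Prod.mk.injEq, true_and]
    rw [Bool.eq_iff_iff]
    rw [pow_one] at e
    simp only [Bool.and_eq_true, decide_eq_true_eq, Bool.not_eq_true']
    rcases h7 : (x (r + 1)).testBit 0 <;> rw [h7] at e <;> simp at e ⊢ <;> omega
  · rw [pow_one] at e
    zify at e h6
    push_cast
    linarith

theorem rowAutomaton_accepts (hL : 1 ≤ L) (hW : 2 * L + 2 < 2 ^ L) (hd : d < 2 ^ L)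
    (hx : ∀ r, x r < 2 ^ L) (hb : ∀ r, x r + (2 * L + 2) = x (r + 1) + (b r).toNat * d)
    {w : List AnnotatedLetter} (hw : ∀ (i : ℕ) (hi : i < w.length),
      w[i] = rowLetter L d x b (i / (2 * L + 2)) (i % (2 * L + 2)))
    (h1 : 1 ≤ w.length / (2 * L + 2)) (h2 : x (w.length / (2 * L + 2)) = 0) :
    (rowAutomaton L).Accepts w := by
  rw [rowAutomaton, TwoNFA.oneWay_accepts_iff]
  refine ⟨fun i => rowRun L d x b (i / (2 * L + 2)) (i % (2 * L + 2)), by simp [rowRun],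
    fun i _ => rowRun_mem hb _ (Nat.mod_lt _ (by omega)), fun i hi => ?_, ?_⟩
  · rw [hw i hi]
    have hlt := Nat.mod_lt i (show 0 < 2 * L + 2 by omega)
    have hdm := Nat.div_add_mod i (2 * L + 2)
    rcases (show i % (2 * L + 2) < 2 * L + 1 ∨ i % (2 * L + 2) = 2 * L + 1 by omega) with h | h
    · have e : i + 1 = (2 * L + 2) * (i / (2 * L + 2)) + (i % (2 * L + 2) + 1) := by omega
      have e1 : (i + 1) / (2 * L + 2) = i / (2 * L + 2) := by
        exact Nat.div_eq_of_lt_le (by rw [mul_comm]; omega) (by rw [mul_comm, Nat.mul_succ]; omega)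
      have e2 : (i + 1) % (2 * L + 2) = i % (2 * L + 2) + 1 := by
        rw [e, Nat.mul_add_mod, Nat.mod_eq_of_lt (by omega)]
      simp only [e1, e2]
      exact rowNext_rowRun hW hd hx _ h
    · have e : i + 1 = (2 * L + 2) * (i / (2 * L + 2) + 1) := by rw [Nat.mul_succ]; omega
      have e1 : (i + 1) / (2 * L + 2) = i / (2 * L + 2) + 1 := by
        rw [e, Nat.mul_div_cancel_left _ (by omega)]
      have e2 : (i + 1) % (2 * L + 2) = 0 := by rw [e, Nat.mul_mod_right]
      simp only [e1, e2, h]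
      exact rowNext_rowRun_last hL hb _
  · have e : decide (1 ≤ w.length / (2 * L + 2) ∧ x (w.length / (2 * L + 2)) = 0) = true := by
      simp only [h1, h2, and_self, decide_true]
    simp only [Set.mem_ofPred_eq, rowRun]
    split_ifs <;> exact e

end

/-! ### The first row -/

/-- States of the automaton that checks the first row: column and prefix of `x`, prefix of `K - d`
(at most `1`), prefix of `d` (at most `2`). Behind the first row the second component counts down
modulo the length of a row. -/
abbrev HeadState : Type := (ℕ × ℕ) × ℤ × ℕ

/-- Moves of the automaton that checks the first row. -/
def headNext (L K : ℕ) : HeadState → AnnotatedLetter → Option HeadState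
  | ((i, u), γ, e), a =>
    if i < 2 then some ((i + 1, u), γ, e)
    else if i < 2 * L + 2 then
      if i % 2 = 0 then
        some ((i + 1, 2 * u + a.2.2.toNat),
          min 1 (2 * γ + ((K.testBit (L - i / 2)).toNat : ℤ) - (a.2.1.toNat : ℤ)),
          min 2 (2 * e + a.2.1.toNat))
      else some ((i + 1, u), γ, e)
    else some ((i, (u + (2 * L + 1)) % (2 * L + 2)), γ, e)

/-- The columns and the prefixes that can be completed to a number less than `2 * L + 2`. -/
def headPrefixes (L : ℕ) : Finset (ℕ × ℕ) :=
  (Finset.range (2 * L + 3)).biUnion fun i =>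
    (Finset.range ((2 * L + 1) / 2 ^ (L - (i - 1) / 2) + 1)).image (Prod.mk i)

theorem mem_headPrefixes {L i u : ℕ} : (i, u) ∈ headPrefixes L ↔
    i ≤ 2 * L + 2 ∧ u ≤ (2 * L + 1) / 2 ^ (L - (i - 1) / 2) := by
  simp only [headPrefixes, Finset.mem_biUnion, Finset.mem_range, Finset.mem_image, Prod.mk.injEq]
  constructor
  · rintro ⟨j, hj, v, hv, rfl, rfl⟩
    omega
  · rintro ⟨h1, h2⟩
    exact ⟨i, by omega, u, by omega, rfl, rfl⟩

theorem sum_range_two_mul_div_two (h : ℕ → ℕ) (n : ℕ) :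
    ∑ i ∈ Finset.range (2 * n), h (i / 2) = 2 * ∑ i ∈ Finset.range n, h i := by
  induction n with
  | zero => simp
  | succ n ih =>
    rw [show 2 * (n + 1) = 2 * n + 1 + 1 by ring, Finset.sum_range_succ, Finset.sum_range_succ, ih,
      Finset.sum_range_succ, show (2 * n + 1) / 2 = n by omega, show 2 * n / 2 = n by omega]
    ring

theorem card_headPrefixes_le (L : ℕ) : (headPrefixes L).card ≤ 7 * (2 * L + 3) := by
  have h1 : (headPrefixes L).card ≤
      ∑ i ∈ Finset.range (2 * L + 3), ((2 * L + 1) / 2 ^ (L - (i - 1) / 2) + 1) := by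
    refine Finset.card_biUnion_le.trans (Finset.sum_le_sum fun i _ => ?_)
    exact Finset.card_image_le.trans (by simp)
  have h2 : ∑ q ∈ Finset.range (L + 1), (2 * L + 1) / 2 ^ (L - q) ≤ 2 * (2 * L + 1) := by
    have h3 := Finset.sum_range_reflect (fun r => (2 * L + 1) / 2 ^ r) (L + 1)
    have h4 := Nat.geom_sum_le (b := 2) le_rfl (2 * L + 1) (L + 1)
    simp only [Nat.add_sub_cancel] at h3
    rw [h3]
    omega
  have h5 := sum_range_two_mul_div_two (fun q => (2 * L + 1) / 2 ^ (L - q)) (L + 1)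
  have h6 : (2 * L + 1) / 2 ^ L ≤ 2 * L + 1 := Nat.div_le_self _ _
  refine h1.trans ?_
  rw [Finset.sum_add_distrib, Finset.sum_range_succ']
  simp only [Nat.add_sub_cancel, Finset.sum_const, Finset.card_range, smul_eq_mul, mul_one,
    Nat.zero_sub, Nat.zero_div, Nat.sub_zero]
  rw [show 2 * L + 2 = 2 * (L + 1) by ring, h5]
  omega

/-- The states of the automaton that checks the first row. -/
noncomputable def headStates (L : ℕ) : Finset HeadState :=
  headPrefixes L ×ˢ Finset.Icc 0 1 ×ˢ Finset.range 3

theorem card_headStates_le (L : ℕ) : (headStates L).card ≤ 42 * (2 * L + 3) := by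
  have := card_headPrefixes_le L
  simp [headStates, Finset.card_product]
  omega

/-- The automaton that checks that the first row encodes a number `d` with `2 ≤ d ≤ K` and the
remainder `x` of the length of the word modulo the length of a row. -/
noncomputable def headAutomaton (L K : ℕ) : TwoNFA AnnotatedLetter (headStates L) :=
  TwoNFA.oneWay (headStates L) (headNext L K)
    ⟨((0, 0), 0, 0), by simp [headStates, mem_headPrefixes]⟩
    {q | q.1 = (2 * L + 2, 0) ∧ q.2.2 = 2}

theorem of_headAutomaton_accepts {L K : ℕ} (hK : K < 2 ^ L) {w : List AnnotatedLetter}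
    (h : (headAutomaton L K).Accepts w) {g : ℕ → AnnotatedLetter}
    (hg : ∀ (i : ℕ) (hi : i < w.length), g i = w[i]) :
    digitVal (fun j => (g (2 * j + 2)).2.2) L = w.length % (2 * L + 2) ∧
    2 ≤ digitVal (fun j => (g (2 * j + 2)).2.1) L ∧
    digitVal (fun j => (g (2 * j + 2)).2.1) L ≤ K := by
  rw [headAutomaton, TwoNFA.oneWay_accepts_iff] at h
  obtain ⟨s, h0, hF, hs, hacc⟩ := h
  replace hs : ∀ i < w.length, headNext L K (s i) (g i) = some (s (i + 1)) := fun i hi => by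
    rw [hg i hi]
    exact hs i hi
  have hle : ∀ i ≤ w.length, (s i).1.1 ≤ i := by
    intro i
    induction i with
    | zero => intro _; simp [h0]
    | succ i ih =>
      intro hi
      have h1 := ih (by omega)
      have h2 := hs i hi
      rcases hsi : s i with ⟨⟨k, u⟩, γ, e⟩
      rw [hsi] at h1 h2
      simp only [headNext] at h2 h1
      split_ifs at h2 <;> simp only [Option.some.injEq] at h2 <;> rw [← h2] <;> simp only <;> omega
  have hlen : 2 * L + 2 ≤ w.length := by
    have h1 := hle _ le_rfl
    rw [hacc.1] at h1
    exact h1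
  set X : ℕ → ℕ := digitVal (fun j => (g (2 * j + 2)).2.2) with hX
  set D : ℕ → ℕ := digitVal (fun j => (g (2 * j + 2)).2.1) with hD
  have hrow : ∀ j ≤ L, s (2 * j + 2) = ((2 * j + 2, X j),
      min 1 (((K / 2 ^ (L - j) : ℕ) : ℤ) - D j), min 2 (D j)) ∧ D j ≤ K / 2 ^ (L - j) := by
    intro j
    induction j with
    | zero =>
      intro _
      have h1 := hs 0 (by omega)
      have h2 := hs 1 (by omega)
      rw [h0] at h1
      simp only [headNext, Nat.zero_lt_two, if_true, Option.some.injEq] at h1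
      rw [← h1] at h2
      simp only [headNext, zero_add, Nat.one_lt_two, if_true, Option.some.injEq] at h2
      refine ⟨?_, by simp [hD, digitVal]⟩
      simp only [mul_zero, zero_add]
      rw [← h2]
      simp [hX, hD, digitVal, Nat.div_eq_of_lt hK]
    | succ j ih =>
      intro hj
      obtain ⟨h1, h2⟩ := ih (by omega)
      have h3 := hs (2 * j + 2) (by omega)
      have e1 : ¬ 2 * j + 2 < 2 := by omega
      have e2 : 2 * j + 2 < 2 * L + 2 := by omega
      have e3 : (2 * j + 2) % 2 = 0 := by omega
      rw [h1, headNext, if_neg e1, if_pos e2, if_pos e3, Option.some.injEq] at h3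
      have h4 := hs (2 * j + 2 + 1) (by omega)
      have e4 : ¬ 2 * j + 2 + 1 < 2 := by omega
      have e5 : 2 * j + 2 + 1 < 2 * L + 2 := by omega
      have e6 : ¬ (2 * j + 2 + 1) % 2 = 0 := by omega
      rw [← h3, headNext, if_neg e4, if_pos e5, if_neg e6, Option.some.injEq] at h4
      have h5 := div_two_pow_eq K (L - (j + 1))
      rw [show L - (j + 1) + 1 = L - j by omega] at h5
      have h6 : D (j + 1) = 2 * D j + (g (2 * j + 2)).2.1.toNat := rfl
      have h7 : X (j + 1) = 2 * X j + (g (2 * j + 2)).2.2.toNat := rfl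
      have hγ := hF (2 * j + 2 + 1 + 1) (by omega)
      rw [← h4] at hγ
      simp only [headStates, Finset.mem_product, Finset.mem_Icc] at hγ
      have hγ' := hγ.2.1.1
      rw [show L - (2 * j + 2) / 2 = L - (j + 1) by omega] at hγ' h4
      have hbit := Bool.toNat_le (g (2 * j + 2)).2.1
      have h8 : D (j + 1) ≤ K / 2 ^ (L - (j + 1)) := by
        rw [h5, h6]
        omega
      refine ⟨?_, h8⟩
      rw [show 2 * (j + 1) + 2 = 2 * j + 2 + 1 + 1 by ring, ← h4, h5, h6, h7]
      simp only [Prod.mk.injEq, true_and]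
      refine ⟨?_, ?_⟩
      · push_cast
        omega
      · omega
  obtain ⟨h1, h2⟩ := hrow L le_rfl
  rw [Nat.sub_self, pow_zero, Nat.div_one] at h2
  have hXle : X L < 2 * L + 2 := by
    have h3 := hF (2 * L + 2) hlen
    rw [h1] at h3
    simp only [headStates, Finset.mem_product, mem_headPrefixes] at h3
    have h4 := h3.1.2
    rw [show L - (2 * L + 2 - 1) / 2 = 0 by omega, pow_zero, Nat.div_one] at h4
    omega
  have htail : ∀ t, 2 * L + 2 + t ≤ w.length → ∃ u, (s (2 * L + 2 + t)).1 = (2 * L + 2, u) ∧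
      (s (2 * L + 2 + t)).2.2 = min 2 (D L) ∧ (u + t) % (2 * L + 2) = X L := by
    intro t
    induction t with
    | zero =>
      intro _
      rw [add_zero, h1]
      exact ⟨X L, rfl, rfl, Nat.mod_eq_of_lt hXle⟩
    | succ t ih =>
      intro ht
      obtain ⟨u, h3, h4, h5⟩ := ih (by omega)
      have h6 := hs (2 * L + 2 + t) (by omega)
      rcases hst : s (2 * L + 2 + t) with ⟨⟨i, u'⟩, γ, e⟩
      rw [hst] at h3 h4 h6
      simp only [Prod.mk.injEq] at h3 h4
      obtain ⟨rfl, rfl⟩ := h3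
      rw [headNext, if_neg (by omega), if_neg (by omega), Option.some.injEq] at h6
      rw [← add_assoc, ← h6]
      refine ⟨_, rfl, h4, ?_⟩
      rw [Nat.mod_add_mod, show u' + (2 * L + 1) + (t + 1) = u' + t + (2 * L + 2) by ring,
        Nat.add_mod_right, h5]
  obtain ⟨u, h3, h4, h5⟩ := htail (w.length - (2 * L + 2)) (by omega)
  rw [show 2 * L + 2 + (w.length - (2 * L + 2)) = w.length by omega] at h3 h4
  obtain ⟨h6, h7⟩ := hacc
  rw [h6] at h3
  simp only [Prod.mk.injEq, true_and] at h3
  subst h3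
  refine ⟨?_, by omega, h2⟩
  rw [← h5, zero_add]
  exact (Nat.mod_eq_sub_mod hlen).symm

/-- The state of the automaton on the first row after `i` letters of an annotation that encodes
`d` and `x`. -/
def headRun (L K d x i : ℕ) : HeadState :=
  if i < 2 * L + 2 then
    ((i, x / 2 ^ (L - (i - 1) / 2)),
      min 1 (((K / 2 ^ (L - (i - 1) / 2) : ℕ) : ℤ) - (d / 2 ^ (L - (i - 1) / 2) : ℕ)),
      min 2 (d / 2 ^ (L - (i - 1) / 2)))
  else ((2 * L + 2, (x + (i - (2 * L + 2)) * (2 * L + 1)) % (2 * L + 2)), min 1 ((K : ℤ) - d), 2)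

theorem headAutomaton_accepts {L K d : ℕ} (hK : K < 2 ^ L) (hL : 2 * L + 2 < 2 ^ L)
    (hd : 2 ≤ d) (hdK : d ≤ K) {w : List AnnotatedLetter} (hlen : 2 * L + 2 ≤ w.length)
    (hw : ∀ (j : ℕ) (hj : 2 * j + 2 < w.length), j < L → w[2 * j + 2] = ((),
      d.testBit (L - (j + 1)), (w.length % (2 * L + 2)).testBit (L - (j + 1)))) :
    (headAutomaton L K).Accepts w := by
  rw [headAutomaton, TwoNFA.oneWay_accepts_iff]
  set x := w.length % (2 * L + 2) with hx
  have hxlt : x < 2 * L + 2 := Nat.mod_lt _ (by omega)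
  refine ⟨headRun L K d x, ?_, fun i _ => ?_, fun i hi => ?_, ?_⟩
  · simp [headRun, Nat.div_eq_of_lt hK, Nat.div_eq_of_lt (hdK.trans_lt hK),
      Nat.div_eq_of_lt (hxlt.trans hL)]
  · have h1 (q : ℕ) : d / q ≤ K / q := Nat.div_le_div_right hdK
    unfold headRun
    split_ifs with h
    · simp only [headStates, Finset.mem_product, mem_headPrefixes, Finset.mem_Icc, Finset.mem_range]
      have h2 := h1 (2 ^ (L - (i - 1) / 2))
      have h3 : x / 2 ^ (L - (i - 1) / 2) ≤ (2 * L + 1) / 2 ^ (L - (i - 1) / 2) :=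
        Nat.div_le_div_right (by omega)
      omega
    · have h3 := Nat.mod_lt (x + (i - (2 * L + 2)) * (2 * L + 1)) (show 0 < 2 * L + 2 by omega)
      simp only [headStates, Finset.mem_product, mem_headPrefixes, Finset.mem_Icc, Finset.mem_range]
      rw [show L - (2 * L + 2 - 1) / 2 = 0 by omega, pow_zero, Nat.div_one]
      omega
  · by_cases h1 : i < 2
    · have e1 : (i - 1) / 2 = 0 := by omega
      have e2 : (i + 1 - 1) / 2 = 0 := by omega
      rw [headRun, if_pos (by omega), headNext, if_pos h1, e1]
      by_cases hL0 : i + 1 < 2 * L + 2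
      · rw [headRun, if_pos hL0, e2]
      · have : L = 0 := by omega
        subst this
        simp at hL
    by_cases h2 : i < 2 * L + 2
    · have h6 : headRun L K d x (i + 1) = ((i + 1, x / 2 ^ (L - i / 2)),
          min 1 (((K / 2 ^ (L - i / 2) : ℕ) : ℤ) - (d / 2 ^ (L - i / 2) : ℕ)),
          min 2 (d / 2 ^ (L - i / 2))) := by
        by_cases h3 : i + 1 < 2 * L + 2
        · rw [headRun, if_pos h3, Nat.add_sub_cancel]
        · rw [headRun, if_neg h3, show i + 1 - (2 * L + 2) = 0 by omega,
            show L - i / 2 = 0 by omega, zero_mul, add_zero, Nat.mod_eq_of_lt hxlt, pow_zero,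
            Nat.div_one, Nat.div_one, Nat.div_one, min_eq_left hd,
            show i + 1 = 2 * L + 2 by omega]
      rw [h6, headRun, if_pos h2, headNext, if_neg h1, if_pos h2]
      rcases Nat.mod_two_eq_zero_or_one i with h4 | h4
      · have h5 := hw (i / 2 - 1) (by omega) (by omega)
        simp only [show 2 * (i / 2 - 1) + 2 = i by omega,
          show i / 2 - 1 + 1 = i / 2 by omega] at h5
        rw [if_pos h4, h5]
        have e (v : ℕ) := div_two_pow_eq v (L - i / 2)
        rw [show L - i / 2 + 1 = L - (i - 1) / 2 by omega] at e
        have h7 : d / 2 ^ (L - (i - 1) / 2) ≤ K / 2 ^ (L - (i - 1) / 2) := Nat.div_le_div_right hdK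
        have h8 := Bool.toNat_le (d.testBit (L - i / 2))
        rw [e K, e d, e x]
        simp only [Option.some.injEq, Prod.mk.injEq, true_and]
        refine ⟨?_, ?_⟩
        · push_cast
          omega
        · omega
      · rw [if_neg (by omega), show (i - 1) / 2 = i / 2 by omega]
    · rw [headRun, if_neg h2, headNext, if_neg (by omega), if_neg (by omega), headRun,
        if_neg (by omega), Nat.mod_add_mod, show i + 1 - (2 * L + 2) = i - (2 * L + 2) + 1 by omega,
        Nat.succ_mul (i - (2 * L + 2)), add_assoc]
  · rw [headRun, if_neg (by omega)]
    refine ⟨?_, rfl⟩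
    simp only [Prod.mk.injEq, true_and]
    have h1 : x = (w.length - (2 * L + 2)) % (2 * L + 2) := Nat.mod_eq_sub_mod hlen
    have h2 : x + (w.length - (2 * L + 2)) * (2 * L + 1) ≡
        (w.length - (2 * L + 2)) + (w.length - (2 * L + 2)) * (2 * L + 1) [MOD 2 * L + 2] :=
      Nat.ModEq.add_right _ (by rw [h1]; exact Nat.mod_modEq _ _)
    rw [h2, show w.length - (2 * L + 2) + (w.length - (2 * L + 2)) * (2 * L + 1) =
      (w.length - (2 * L + 2)) * (2 * L + 2) by ring, Nat.mul_mod_left]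

/-! ### Divisors in a bounded range -/

/-- The automaton over annotated unary words that checks an annotation proving that the length of
the word has a divisor `d` such that `1 < d ≤ K`. -/
noncomputable def divisorAutomaton (L K : ℕ) :
    TwoNFA AnnotatedLetter (Option (TwoNFA.gapStates (min K (2 * L + 2)) ⊕
      (TwoNFA.shiftStates AnnotatedLetter (2 * L + 1) ⊕ Unit ⊕ (rowStates L ⊕ Unit ⊕ headStates L)))) :=
  TwoNFA.choice (fun a => a.2.1 = true)
    (TwoNFA.gapAutomaton (fun a => a.2.2) (min K (2 * L + 2)))
    ((TwoNFA.shiftAutomaton AnnotatedLetter (2 * L + 1)).inter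
      ((rowAutomaton L).inter (headAutomaton L K)))

theorem divisorAutomaton_isDeterministic (L K : ℕ) : (divisorAutomaton L K).IsDeterministic :=
  TwoNFA.choice_isDeterministic (TwoNFA.ofFun_isDeterministic _ _ _ _)
    (TwoNFA.inter_isDeterministic (TwoNFA.ofFun_isDeterministic _ _ _ _)
      (TwoNFA.inter_isDeterministic (TwoNFA.oneWay_isDeterministic _ _ _ _)
        (TwoNFA.oneWay_isDeterministic _ _ _ _)))

theorem card_divisorAutomaton_le (L K : ℕ) :
    Fintype.card (Option (TwoNFA.gapStates (min K (2 * L + 2)) ⊕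
      (TwoNFA.shiftStates AnnotatedLetter (2 * L + 1) ⊕ Unit ⊕ (rowStates L ⊕ Unit ⊕ headStates L)))) ≤
      200 * (2 * L + 3) := by
  have h1 := TwoNFA.card_gapStates_le (min K (2 * L + 2))
  have h2 := TwoNFA.card_shiftStates_le (α := AnnotatedLetter) (2 * L + 1)
  have h3 := card_rowStates L
  have h4 := card_headStates_le L
  have h5 : min K (2 * L + 2) ≤ 2 * L + 2 := min_le_right _ _
  simp only [Fintype.card_prod, Fintype.card_unit, Fintype.card_bool] at h2
  simp only [Fintype.card_option, Fintype.card_sum, Fintype.card_coe, Fintype.card_unit]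
  omega

theorem exists_divisor_of_divisorAutomaton_accepts {L K : ℕ} (hL : 1 ≤ L) (hW : 2 * L + 2 < 2 ^ L)
    (hK : K < 2 ^ L) (hK2 : 2 ≤ K) {w : List AnnotatedLetter}
    (h : (divisorAutomaton L K).Accepts w) : ∃ d, 1 < d ∧ d ≤ K ∧ d ∣ w.length := by
  rcases TwoNFA.of_choice_accepts h with rfl | h | h
  · exact ⟨2, by omega, hK2, by simp⟩
  · obtain ⟨d, h1, h2, h3⟩ := TwoNFA.exists_dvd_of_gapAutomaton_accepts h
    exact ⟨d, h1, h2.trans (min_le_left _ _), h3⟩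
  · rw [TwoNFA.inter_accepts_iff, TwoNFA.inter_accepts_iff] at h
    obtain ⟨hshift, hrow, hhead⟩ := h
    let g : ℕ → AnnotatedLetter := fun i => w.getD i default
    have hg : ∀ (i : ℕ) (hi : i < w.length), g i = w[i] := fun i hi => by simp [g, hi]
    have hdm := Nat.div_add_mod w.length (2 * L + 2)
    obtain ⟨hR, hlast, hrows⟩ := of_rowAutomaton_accepts hL hW hrow hg
    obtain ⟨hx0, hd2, hdK⟩ := of_headAutomaton_accepts hK hhead hg
    set R := w.length / (2 * L + 2) with hRdef
    have hcopy : ∀ r, r + 1 < R → ∀ j < L,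
        g ((2 * L + 2) * (r + 1) + (2 * j + 2)) = g ((2 * L + 2) * r + (2 * j + 3)) := by
      intro r hr j hj
      have h1 : (2 * L + 2) * (r + 2) ≤ (2 * L + 2) * R := Nat.mul_le_mul_left _ hr
      have h2 : (2 * L + 2) * (r + 2) = (2 * L + 2) * r + 2 * (2 * L + 2) := by ring
      have h3 : (2 * L + 2) * (r + 1) + (2 * j + 2) =
        (2 * L + 2) * r + (2 * j + 3) + (2 * L + 1) := by ring
      have h4 : (2 * L + 2) * r = 2 * ((L + 1) * r) := by ring
      rw [h3, hg _ (by omega), hg _ (by omega)]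
      exact TwoNFA.eq_of_shiftAutomaton_accepts (by omega) hshift _ (by omega) (by omega)
    set d := digitVal (fun j => (g (2 * j + 2)).2.1) L with hd
    have key : ∀ r < R, digitVal (fun j => (g ((2 * L + 2) * r + (2 * j + 2))).2.1) L = d ∧
        ∃ c, digitVal (fun j => (g ((2 * L + 2) * r + (2 * j + 3))).2.2) L + c * d =
          w.length % (2 * L + 2) + (2 * L + 2) * (r + 1) := by
      intro r
      induction r with
      | zero =>
        intro h0
        obtain ⟨b, hb⟩ := (hrows 0 h0).2
        simp only [mul_zero, zero_add] at hb ⊢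
        rw [hx0] at hb
        exact ⟨rfl, b.toNat, by rw [← hb, mul_one]⟩
      | succ r ih =>
        intro hr
        obtain ⟨ih1, c, ih2⟩ := ih (by omega)
        have h1 : digitVal (fun j => (g ((2 * L + 2) * (r + 1) + (2 * j + 2))).2.1) L = d := by
          rw [← ih1]
          refine digitVal_congr fun j hj => ?_
          rw [hcopy r hr j hj]
          exact (hrows r (by omega)).1 j hj
        have h2 : digitVal (fun j => (g ((2 * L + 2) * (r + 1) + (2 * j + 2))).2.2) L =
            digitVal (fun j => (g ((2 * L + 2) * r + (2 * j + 3))).2.2) L :=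
          digitVal_congr fun j hj => by rw [hcopy r hr j hj]
        obtain ⟨b, hb⟩ := (hrows (r + 1) hr).2
        rw [h1, h2] at hb
        refine ⟨h1, c + b.toNat, ?_⟩
        linarith
    obtain ⟨-, c, hc⟩ := key (R - 1) (by omega)
    rw [hlast, zero_add, Nat.sub_add_cancel hR, add_comm, hdm] at hc
    exact ⟨d, hd2, hdK, ⟨c, by rw [← hc, mul_comm]⟩⟩

theorem exists_divisorAutomaton_accepts {L K : ℕ} (hL : 1 ≤ L) (hW : 2 * L + 2 < 2 ^ L)
    (hK : K < 2 ^ L) {m d : ℕ} (hd : 1 < d) (hdK : d ≤ K) (hm : d ∣ m) :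
    ∃ w : List AnnotatedLetter, w.length = m ∧ (divisorAutomaton L K).Accepts w := by
  rcases Nat.eq_zero_or_pos m with rfl | hpos
  · exact ⟨[], rfl, TwoNFA.choice_accepts_nil _ _ _⟩
  rcases le_or_gt d (2 * L + 2) with hdW | hdW
  · let w : List AnnotatedLetter := (List.range m).map fun i => ((), true, decide (d ∣ i + 1))
    have hlen : w.length = m := by simp [w]
    have hw : (TwoNFA.gapAutomaton (fun a : AnnotatedLetter => a.2.2)
        (min K (2 * L + 2))).Accepts w := by
      obtain ⟨k, rfl⟩ := hm
      refine TwoNFA.gapAutomaton_accepts (d := d) (k := k) hd (le_min hdK hdW)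
        (Nat.pos_of_mul_pos_left hpos) (by rw [hlen, mul_comm]) fun i hi => ?_
      simp [w]
    refine ⟨w, hlen, ?_⟩
    obtain ⟨m, rfl⟩ : ∃ k, m = k + 1 := ⟨m - 1, by omega⟩
    rw [show w = ((), true, decide (d ∣ 0 + 1)) ::
      (List.range m).map fun i => ((), true, decide (d ∣ i + 1 + 1)) by
        simp [w, List.range_succ_eq_map]] at hw ⊢
    exact TwoNFA.choice_accepts_left rfl hw
  · let x : ℕ → ℕ := fun r => (m % (2 * L + 2) + (2 * L + 2) * r) % d
    let b : ℕ → Bool := fun r => decide (d ≤ x r + (2 * L + 2))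
    have hxd : ∀ r, x r < d := fun r => Nat.mod_lt _ (by omega)
    have hx0 : x 0 = m % (2 * L + 2) := by
      have := Nat.mod_lt m (show 0 < 2 * L + 2 by omega)
      simp only [x, mul_zero, add_zero]
      exact Nat.mod_eq_of_lt (by omega)
    have hb : ∀ r, x r + (2 * L + 2) = x (r + 1) + (b r).toNat * d := by
      intro r
      have h1 : x (r + 1) = (x r + (2 * L + 2)) % d := by
        simp only [x]
        rw [Nat.mod_add_mod]
        congr 1
        ring
      have h2 := hxd r
      rw [h1]
      by_cases h3 : d ≤ x r + (2 * L + 2)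
      · have h4 : (b r).toNat = 1 := by simp [b, h3]
        rw [h4, Nat.mod_eq_sub_mod h3, Nat.mod_eq_of_lt (by omega)]
        omega
      · have h4 : (b r).toNat = 0 := by simp [b, h3]
        rw [h4, Nat.mod_eq_of_lt (by omega)]
        omega
    let f : ℕ → AnnotatedLetter := fun i => rowLetter L d x b (i / (2 * L + 2)) (i % (2 * L + 2))
    let w : List AnnotatedLetter := (List.range m).map f
    have hlen : w.length = m := by simp [w]
    have hf : ∀ r c, c < 2 * L + 2 → f ((2 * L + 2) * r + c) = rowLetter L d x b r c := by
      intro r c hc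
      simp only [f]
      rw [Nat.mul_add_div (by omega), Nat.mul_add_mod, Nat.div_eq_of_lt hc, Nat.mod_eq_of_lt hc,
        add_zero]
    have hmd : 2 * L + 2 ≤ m := (hdW.le.trans (Nat.le_of_dvd hpos hm))
    have hshift : (TwoNFA.shiftAutomaton AnnotatedLetter (2 * L + 1)).Accepts w := by
      refine TwoNFA.shiftAutomaton_accepts (by omega) fun i hi hodd => ?_
      simp only [w, List.getElem_map, List.getElem_range]
      have h1 := Nat.div_add_mod i (2 * L + 2)
      have h2 := Nat.mod_lt i (show 0 < 2 * L + 2 by omega)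
      set r := i / (2 * L + 2)
      set c := i % (2 * L + 2)
      have h3 : (2 * L + 2) * r = 2 * ((L + 1) * r) := by ring
      have h4 : c % 2 = 1 := by omega
      rw [show i + (2 * L + 1) = (2 * L + 2) * (r + 1) + (c - 1) by rw [Nat.mul_succ]; omega,
        hf _ _ (by omega), ← h1, hf _ _ h2, rowLetter, rowLetter]
      rcases (show c = 1 ∨ 2 ≤ c by omega) with h5 | h5
      · simp [h5]
      · rw [if_neg (by omega), if_neg (by omega), show (c - 1) / 2 = c / 2 by omega,
          show (c - 1) % 2 = 0 by omega, h4, add_zero]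
    have hrow : (rowAutomaton L).Accepts w := by
      refine rowAutomaton_accepts hL hW (hdK.trans_lt hK)
        (fun r => (hxd r).trans (hdK.trans_lt hK)) hb (fun i hi => by simp [w, f]) ?_ ?_
      · rw [hlen]
        exact Nat.div_pos hmd (by omega)
      · rw [hlen]
        simp only [x]
        rw [add_comm, Nat.div_add_mod]
        exact Nat.mod_eq_zero_of_dvd hm
    have hhead : (headAutomaton L K).Accepts w := by
      refine headAutomaton_accepts hK hW hd hdK (by rwa [hlen]) fun j hj hjL => ?_
      simp only [w, List.getElem_map, List.getElem_range, List.length_map, List.length_range]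
      have h1 := hf 0 (2 * j + 2) (by omega)
      rw [mul_zero, zero_add] at h1
      rw [h1, rowLetter, if_neg (by omega), show (2 * j + 2) / 2 = j + 1 by omega,
        show (2 * j + 2) % 2 = 0 by omega, add_zero, hx0]
    have hw := TwoNFA.inter_accepts_iff.mpr ⟨hshift, TwoNFA.inter_accepts_iff.mpr ⟨hrow, hhead⟩⟩
    refine ⟨w, hlen, ?_⟩
    obtain ⟨m', hm'⟩ : ∃ k, m = k + 1 := ⟨m - 1, by omega⟩
    have hcons : w = f 0 :: (List.range m').map (fun i => f (i + 1)) := by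
      simp only [w, hm', List.range_succ_eq_map, List.map_cons, List.map_map]
      rfl
    rw [hcons] at hw ⊢
    exact TwoNFA.choice_accepts_right (by simp [f, rowLetter]) hw

theorem list_unit_eq_replicate (w : List Unit) : w = List.replicate w.length () := by
  rw [List.eq_replicate_iff]
  simp

theorem mem_unaryM_iff {n : ℕ} {w : List Unit} :
    w ∈ unaryM n ↔ ∃ d, 1 < d ∧ d ≤ 2 ^ n * (n + 1) + 1 ∧ d ∣ w.length := by
  constructor
  · rintro ⟨k, d, h1, h2, rfl⟩
    exact ⟨d, h1, h2, by simp⟩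
  · rintro ⟨d, h1, h2, k, hk⟩
    exact ⟨k, d, h1, h2, by rw [mul_comm, ← hk]; exact list_unit_eq_replicate w⟩

theorem exists_linear_twoDFACommonGuess : ∃ s : ℕ → ℕ,
    Asymptotics.IsBigO Filter.atTop (fun n : ℕ => (s n : ℝ)) (fun n : ℕ => (n : ℝ)) ∧
    ∀ n : ℕ, RecognizedByTwoDFACommonGuess (unaryM n) (s n) 4 := by
  refine ⟨fun n => Fintype.card (Option (TwoNFA.gapStates (min (2 ^ n * (n + 1) + 1)
    (2 * (2 * n + 5) + 2)) ⊕ (TwoNFA.shiftStates AnnotatedLetter (2 * (2 * n + 5) + 1) ⊕ Unit ⊕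
      (rowStates (2 * n + 5) ⊕ Unit ⊕ headStates (2 * n + 5))))), ?_, fun n => ?_⟩
  · refine Asymptotics.IsBigO.of_bound 4000 ?_
    filter_upwards [Filter.eventually_ge_atTop 1] with n hn
    have h1 := card_divisorAutomaton_le (2 * n + 5) (2 ^ n * (n + 1) + 1)
    rw [Real.norm_natCast, Real.norm_natCast]
    exact_mod_cast h1.trans (by omega)
  · have h1 : n < 2 ^ n := Nat.lt_two_pow_self
    have h2 : 2 ^ (2 * n + 5) = 32 * (2 ^ n * 2 ^ n) := by ring
    have h3 : 2 ^ n * (n + 1) ≤ 2 ^ n * 2 ^ n := Nat.mul_le_mul_left _ h1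
    have h4 : 1 * 2 ^ n ≤ 2 ^ n * 2 ^ n := Nat.mul_le_mul_right _ Nat.one_le_two_pow
    have hW : 2 * (2 * n + 5) + 2 < 2 ^ (2 * n + 5) := by omega
    have hK : 2 ^ n * (n + 1) + 1 < 2 ^ (2 * n + 5) := by omega
    have hK2 : 2 ≤ 2 ^ n * (n + 1) + 1 := by
      have : 0 < 2 ^ n * (n + 1) := by positivity
      omega
    refine ⟨_, Bool × Bool, inferInstance, inferInstance,
      ⟨divisorAutomaton (2 * n + 5) (2 ^ n * (n + 1) + 1)⟩,
      divisorAutomaton_isDeterministic _ _, ?_, rfl, by simp⟩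
    ext w
    rw [mem_unaryM_iff]
    constructor
    · rintro ⟨v, hv, rfl⟩
      rw [List.length_map]
      exact exists_divisor_of_divisorAutomaton_accepts (by omega) hW hK hK2 hv
    · rintro ⟨d, hd1, hd2, hd3⟩
      obtain ⟨v, hv1, hv2⟩ := exists_divisorAutomaton_accepts (by omega) hW hK hd1 hd2 hd3
      refine ⟨v, hv2, ?_⟩
      rw [list_unit_eq_replicate w, list_unit_eq_replicate (v.map Prod.fst), List.length_map, hv1]

/-! ### One-way automata -/

theorem exists_divisor_le_iff_exists_prime {K m : ℕ} :
    (∃ d, 1 < d ∧ d ≤ K ∧ d ∣ m) ↔ ∃ p, p.Prime ∧ p ≤ K ∧ p ∣ m := by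
  constructor
  · rintro ⟨d, h1, h2, h3⟩
    exact ⟨d.minFac, Nat.minFac_prime (by omega), (Nat.minFac_le (by omega)).trans h2,
      (Nat.minFac_dvd d).trans h3⟩
  · rintro ⟨p, h1, h2, h3⟩
    exact ⟨p, h1.one_lt, h2, h3⟩

theorem recognizedByOneWayDFA_primorial (n : ℕ) :
    RecognizedByOneWayDFA (unaryM n) (primorial (2 ^ n * (n + 1) + 1)) := by
  set K := 2 ^ n * (n + 1) + 1 with hK
  have hpos := primorial_pos K
  refine ⟨_, inferInstance, TwoNFA.oneWay (Finset.range (primorial K))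
    (fun q (_ : Unit) => some ((q + 1) % primorial K)) ⟨0, by simpa using hpos⟩
    {q | ∃ p, p.Prime ∧ p ≤ K ∧ p ∣ q}, TwoNFA.oneWay_isDeterministic _ _ _ _,
    TwoNFA.oneWay_isOneWay _ _ _ _, ?_, by simp⟩
  ext w
  rw [mem_unaryM_iff, ← hK, exists_divisor_le_iff_exists_prime]
  change TwoNFA.Accepts _ _ ↔ _
  rw [TwoNFA.oneWay_accepts_iff]
  have hdvd : (∃ p, p.Prime ∧ p ≤ K ∧ p ∣ w.length % primorial K) ↔
      ∃ p, p.Prime ∧ p ≤ K ∧ p ∣ w.length := by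
    refine exists_congr fun p => and_congr_right fun hp => and_congr_right fun hpK => ?_
    exact Nat.dvd_mod_iff (hp.dvd_primorial_iff.mpr hpK)
  rw [← hdvd]
  constructor
  · rintro ⟨s, h0, -, hs, hacc⟩
    have key : ∀ i ≤ w.length, s i = i % primorial K := by
      intro i
      induction i with
      | zero => intro _; simpa using h0
      | succ i ih =>
        intro hi
        have := hs i hi
        rw [ih (by omega), Nat.mod_add_mod] at this
        exact (Option.some.inj this).symm
    rwa [key _ le_rfl] at hacc
  · intro h
    exact ⟨fun i => i % primorial K, by simp, fun i _ => by simpa using Nat.mod_lt _ hpos,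
      fun i _ => by simp, h⟩

theorem exists_modEq_coprime_primorial {K p c : ℕ} (hp : p.Prime) (hpK : p ≤ K) (hc : ¬ p ∣ c)
    (b : ℕ) : ∃ u ≥ b, u ≡ c [MOD p] ∧ ∀ q, q.Prime → q ≤ K → ¬ q ∣ u := by
  obtain ⟨P, hP⟩ : p ∣ primorial K := hp.dvd_primorial_iff.mpr hpK
  have hcop : Nat.Coprime p P := Nat.coprime_of_squarefree_mul (hP ▸ squarefree_primorial K)
  obtain ⟨v, hv1, hv2⟩ := Nat.chineseRemainder hcop c 1
  refine ⟨v + primorial K * b, ?_, ?_, ?_⟩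
  · exact (Nat.le_mul_of_pos_left b (primorial_pos K)).trans (Nat.le_add_left _ _)
  · rw [hP, mul_assoc]
    exact (Nat.ModEq.add_left v (Nat.modEq_zero_iff_dvd.mpr (Nat.dvd_mul_right _ _))).trans hv1
  · intro q hq hqK hdvd
    have hqP : q ∣ primorial K := hq.dvd_primorial_iff.mpr hqK
    have hqv : q ∣ v := (Nat.dvd_add_left (hqP.mul_right b)).mp hdvd
    rw [hP] at hqP
    rcases hq.dvd_mul.mp hqP with h | h
    · rw [Nat.prime_dvd_prime_iff_eq hq hp] at h
      subst h
      exact hc ((hv1.dvd_iff dvd_rfl).mp hqv)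
    · exact hq.one_lt.ne' (Nat.dvd_one.mp ((hv2.dvd_iff h).mp hqv))

theorem primorial_le_of_recognizedByOneWayDFA {n m : ℕ}
    (h : RecognizedByOneWayDFA (unaryM n) m) : primorial (2 ^ n * (n + 1) + 1) ≤ m := by
  obtain ⟨Q, _, A, hdet, hone, hlang, rfl⟩ := h
  have hK2 : 2 ≤ 2 ^ n * (n + 1) + 1 := by
    have : 0 < 2 ^ n * (n + 1) := by positivity
    omega
  have hmem : ∀ l, A.Accepts (List.replicate l ()) ↔
      ∃ p, p.Prime ∧ p ≤ 2 ^ n * (n + 1) + 1 ∧ p ∣ l := by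
    intro l
    change List.replicate l () ∈ A.language ↔ _
    rw [hlang, mem_unaryM_iff, exists_divisor_le_iff_exists_prime, List.length_replicate]
  set K := 2 ^ n * (n + 1) + 1
  have hrun : ∀ l, A.Accepts (List.replicate l ()) ↔ ∃ s : ℕ → Q, s 0 = A.start ∧
      (∀ i < l, (s (i + 1), HeadMove.forward) ∈ A.δ (s i) (TapeSymbol.letter ())) ∧
      s l ∈ A.final := by
    intro l
    rw [hone.accepts_iff]
    simp
  by_contra! hlt
  obtain ⟨s, hs0, hs, -⟩ := (hrun (2 * primorial K)).mp
    ((hmem _).mpr ⟨2, Nat.prime_two, hK2, dvd_mul_right _ _⟩)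
  have hinj : ∃ i j, i < j ∧ j < primorial K ∧ s i = s j := by
    obtain ⟨i, j, hij, he⟩ := Fintype.exists_ne_map_eq_of_card_lt
      (fun i : Fin (primorial K) => s i) (by simpa using hlt)
    rcases lt_or_gt_of_ne hij with h | h
    · exact ⟨i, j, h, j.2, he⟩
    · exact ⟨j, i, h, i.2, he.symm⟩
  obtain ⟨i, j, hij, hj, he⟩ := hinj
  obtain ⟨p, hp, hpK, hpij⟩ : ∃ p, p.Prime ∧ p ≤ K ∧ ¬ p ∣ j - i := by
    by_contra! hall
    have hdvd : primorial K ∣ j - i := by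
      refine Finset.prod_primes_dvd _ (fun p hp => ?_) (fun p hp => ?_)
      · exact (Finset.mem_filter.mp hp).2.prime
      · obtain ⟨h1, h2⟩ := Finset.mem_filter.mp hp
        exact hall p h2 (Nat.lt_succ_iff.mp (Finset.mem_range.mp h1))
    have := Nat.le_of_dvd (by omega) hdvd
    omega
  obtain ⟨u, huj, hu1, hu2⟩ := exists_modEq_coprime_primorial hp hpK hpij j
  have hacc : A.Accepts (List.replicate (u - (j - i)) ()) :=
    (hmem _).mpr ⟨p, hp, hpK, (Nat.modEq_iff_dvd' (by omega)).mp hu1.symm⟩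
  obtain ⟨t, ht0, ht, htf⟩ := (hrun _).mp hacc
  have hst : ∀ k ≤ i, s k = t k := by
    intro k
    induction k with
    | zero => intro _; rw [hs0, ht0]
    | succ k ih =>
      intro hk
      have h1 := hs k (by omega)
      have h2 := ht k (by omega)
      rw [ih (by omega)] at h1
      exact congrArg Prod.fst (hdet _ _ h1 h2)
  have hu : A.Accepts (List.replicate u ()) := by
    refine (hrun u).mpr ⟨fun k => if k ≤ j then s k else t (k - (j - i)), by simp [hs0],
      fun k hk => ?_, ?_⟩
    · rcases lt_trichotomy k j with h | rfl | h
      · simpa [h.le, Nat.succ_le_of_lt h] using hs k (by omega)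
      · have := ht i (by omega)
        rw [← hst i le_rfl, he] at this
        simpa [show k + 1 - (k - i) = i + 1 by omega] using this
      · have := ht (k - (j - i)) (by omega)
        simpa [show ¬ k ≤ j by omega, show ¬ k + 1 ≤ j by omega,
          show k + 1 - (j - i) = k - (j - i) + 1 by omega] using this
    · rcases huj.lt_or_eq with h | rfl
      · simpa [show ¬ u ≤ j by omega] using htf
      · rw [show j - (j - i) = i by omega, ← hst i le_rfl, he] at htf
        simpa using htf
  obtain ⟨q, hq, hqK, hqu⟩ := (hmem u).mp hu
  exact hu2 q hq hqK hqu

/-! ### A lower bound for primorials -/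

theorem lcmUpto_le_primorial_mul (n : ℕ) :
    Nat.lcmUpto n ≤ primorial n * n ^ Nat.primeCounting (Nat.sqrt n) := by
  have hle : ∀ p ∈ Nat.primesLE n,
      p ^ Nat.log p n ≤ p * (if p ≤ Nat.sqrt n then n else 1) := by
    intro p hp
    have hprime := Nat.prime_of_mem_primesLE hp
    have hn : n ≠ 0 := by
      rintro rfl
      have := Nat.le_of_mem_primesLE hp
      have := hprime.pos
      omega
    split_ifs with h
    · exact (Nat.pow_log_le_self p hn).trans (Nat.le_mul_of_pos_left _ hprime.pos)
    · have h1 : Nat.log p n < 2 := by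
        apply Nat.log_lt_of_lt_pow hn
        rw [pow_two]
        exact Nat.sqrt_lt.mp (not_le.mp h)
      rw [mul_one]
      calc p ^ Nat.log p n ≤ p ^ 1 := Nat.pow_le_pow_right hprime.pos (by omega)
        _ = p := pow_one p
  rw [Nat.lcmUpto_eq_prod_pow_log]
  refine (Finset.prod_le_prod' hle).trans ?_
  rw [Finset.prod_mul_distrib, ← primorial_eq_prod_primesLE, Finset.prod_ite, Finset.prod_const,
    Finset.prod_const_one, mul_one]
  have hset : (Nat.primesLE n).filter (fun p => p ≤ Nat.sqrt n) = Nat.primesLE (Nat.sqrt n) := by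
    ext p
    simp only [Finset.mem_filter, Nat.mem_primesLE]
    have := Nat.sqrt_le_self n
    constructor
    · rintro ⟨⟨h1, h2⟩, h3⟩
      exact ⟨h3, h2⟩
    · rintro ⟨h1, h2⟩
      exact ⟨⟨h1.trans this, h2⟩, h1⟩
  rw [hset, Nat.primesLE_card_eq_primeCounting]

theorem two_pow_lt_primorial_of_pow_lt {n s : ℕ}
    (hs : Nat.primeCounting (Nat.sqrt (2 ^ n * (n + 1) + 1)) ≤ s)
    (h : (2 ^ n * (n + 1) + 2) ^ (s + 1) < 2 ^ (2 ^ n + 1)) :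
    2 ^ (2 ^ n * n) < primorial (2 ^ n * (n + 1) + 1) := by
  set K := 2 ^ n * (n + 1) + 1 with hK
  by_contra! hle
  have h1 := Chebyshev.two_pow_le_mul_lcmUpto K
  have h2 := lcmUpto_le_primorial_mul K
  have h3 : K ^ Nat.primeCounting (Nat.sqrt K) ≤ (K + 1) ^ s :=
    (Nat.pow_le_pow_left (Nat.le_succ K) _).trans (Nat.pow_le_pow_right (Nat.succ_pos K) hs)
  have h4 : 2 ^ K ≤ (K + 1) ^ (s + 1) * 2 ^ (2 ^ n * n) := by
    calc 2 ^ K ≤ (K + 1) * (2 ^ (2 ^ n * n) * (K + 1) ^ s) :=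
          h1.trans (Nat.mul_le_mul_left _ (h2.trans (Nat.mul_le_mul hle h3)))
      _ = (K + 1) ^ (s + 1) * 2 ^ (2 ^ n * n) := by ring
  have h5 : 2 ^ K = 2 ^ (2 ^ n + 1) * 2 ^ (2 ^ n * n) := by
    rw [← pow_add, hK]
    congr 1
    ring
  rw [h5] at h4
  exact absurd (Nat.le_of_mul_le_mul_right h4 (by positivity)) (not_le.mpr h)

theorem two_pow_lt_primorial_of_le {n e f : ℕ} (he : 2 ^ n * (n + 1) + 2 ≤ 2 ^ e)
    (hf : 2 ^ n * (n + 1) + 1 < 2 ^ f * 2 ^ f) (hef : 2 ^ f * e ≤ 2 ^ n) :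
    2 ^ (2 ^ n * n) < primorial (2 ^ n * (n + 1) + 1) := by
  have hr : Nat.sqrt (2 ^ n * (n + 1) + 1) < 2 ^ f := Nat.sqrt_lt.mpr hf
  refine two_pow_lt_primorial_of_pow_lt (s := Nat.sqrt (2 ^ n * (n + 1) + 1)) ?_ ?_
  · rw [← Nat.primesLE_card_eq_primeCounting]
    refine (Finset.card_le_card (t := Finset.Icc 1 (Nat.sqrt (2 ^ n * (n + 1) + 1)))
      fun p hp => ?_).trans (by simp)
    exact Finset.mem_Icc.mpr ⟨(Nat.prime_of_mem_primesLE hp).pos, Nat.le_of_mem_primesLE hp⟩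
  · calc _ ≤ (2 ^ e) ^ 2 ^ f :=
          (Nat.pow_le_pow_left he _).trans (Nat.pow_le_pow_right (by positivity) hr)
      _ = 2 ^ (2 ^ f * e) := by rw [← pow_mul, mul_comm]
      _ < 2 ^ (2 ^ n + 1) := Nat.pow_lt_pow_right (by norm_num) (by omega)

theorem two_pow_lt_primorial_of_ge {n : ℕ} (hn : 15 ≤ n) :
    2 ^ (2 ^ n * n) < primorial (2 ^ n * (n + 1) + 1) := by
  set j := n / 3 with hj
  have hj5 : 5 ≤ j := by omega
  have h1 : 4 * j + 2 ≤ 2 ^ j := by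
    clear_value j
    clear hj
    induction j, hj5 using Nat.le_induction with
    | base => norm_num
    | succ k hk ih =>
      rw [pow_succ]
      omega
  have h2 : n + j ≤ 2 ^ j := by omega
  have h3 : 2 ^ n * (n + 1) + 2 ≤ 2 ^ (n + j) := by
    have h4 : 2 ^ 1 ≤ 2 ^ n := Nat.pow_le_pow_right (by norm_num) (by omega)
    calc 2 ^ n * (n + 1) + 2 ≤ 2 ^ n * (n + 1) + 2 ^ n := by omega
      _ = 2 ^ n * (n + 2) := by ring
      _ ≤ 2 ^ n * 2 ^ j := Nat.mul_le_mul_left _ (by omega)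
      _ = 2 ^ (n + j) := (pow_add _ _ _).symm
  refine two_pow_lt_primorial_of_le (e := n + j) (f := (n + j + 1) / 2) h3 ?_ ?_
  · rw [← pow_add]
    have : 2 ^ (n + j) ≤ 2 ^ ((n + j + 1) / 2 + (n + j + 1) / 2) :=
      Nat.pow_le_pow_right (by norm_num) (by omega)
    omega
  · calc 2 ^ ((n + j + 1) / 2) * (n + j) ≤ 2 ^ ((n + j + 1) / 2) * 2 ^ j :=
          Nat.mul_le_mul_left _ h2
      _ = 2 ^ ((n + j + 1) / 2 + j) := (pow_add _ _ _).symm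
      _ ≤ 2 ^ n := Nat.pow_le_pow_right (by norm_num) (by omega)

theorem two_pow_lt_primorial (n : ℕ) :
    2 ^ (2 ^ n * n) < primorial (2 ^ n * (n + 1) + 1) := by
  by_cases hn : 15 ≤ n
  · exact two_pow_lt_primorial_of_ge hn
  · have h13 : Nat.primeCounting (Nat.sqrt (2 ^ 13 * (13 + 1) + 1)) ≤ 68 := by decide +kernel
    have h11 : Nat.primeCounting (Nat.sqrt (2 ^ 11 * (11 + 1) + 1)) ≤ 36 := by decide +kernel
    have h10 : Nat.primeCounting (Nat.sqrt (2 ^ 10 * (10 + 1) + 1)) ≤ 27 := by decide +kernel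
    have h9 : Nat.primeCounting (Nat.sqrt (2 ^ 9 * (9 + 1) + 1)) ≤ 20 := by decide +kernel
    have h8 : Nat.primeCounting (Nat.sqrt (2 ^ 8 * (8 + 1) + 1)) ≤ 15 := by decide +kernel
    have h7 : Nat.primeCounting (Nat.sqrt (2 ^ 7 * (7 + 1) + 1)) ≤ 11 := by decide +kernel
    rcases (show n ≤ 6 ∨ n = 7 ∨ n = 8 ∨ n = 9 ∨ n = 10 ∨ n = 11 ∨ n = 12 ∨ n = 13 ∨ n = 14 by
      omega) with h | rfl | rfl | rfl | rfl | rfl | rfl | rfl | rfl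
    · interval_cases n <;> decide +kernel
    · exact two_pow_lt_primorial_of_pow_lt h7 (by decide +kernel)
    · exact two_pow_lt_primorial_of_pow_lt h8 (by decide +kernel)
    · exact two_pow_lt_primorial_of_pow_lt h9 (by decide +kernel)
    · exact two_pow_lt_primorial_of_pow_lt h10 (by decide +kernel)
    · exact two_pow_lt_primorial_of_pow_lt h11 (by decide +kernel)
    · exact two_pow_lt_primorial_of_le (e := 16) (f := 8) (by norm_num) (by norm_num) (by norm_num)
    · exact two_pow_lt_primorial_of_pow_lt h13 (by decide +kernel)
    · exact two_pow_lt_primorial_of_le (e := 18) (f := 9) (by norm_num) (by norm_num) (by norm_num)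

theorem mainTheorem1 :
    (∃ s : ℕ → ℕ,
      Asymptotics.IsBigO Filter.atTop (fun n : ℕ => (s n : ℝ)) (fun n : ℕ => (n : ℝ)) ∧
      ∀ n : ℕ, RecognizedByTwoDFACommonGuess (unaryM n) (s n) 4) ∧
    (∀ n : ℕ,
      IsLeast {m : ℕ | RecognizedByOneWayDFA (unaryM n) m} (primorial (2 ^ n * (n + 1) + 1)) ∧
      primorial (2 ^ n * (n + 1) + 1) > 2 ^ (2 ^ n * n)) :=
  ⟨exists_linear_twoDFACommonGuess, fun n => ⟨⟨recognizedByOneWayDFA_primorial n,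
    fun _ h => primorial_le_of_recognizedByOneWayDFA h⟩, two_pow_lt_primorial n⟩⟩
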